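/- All graphs are finite, undirected and simple. For a graph $G$, let $\kappa(G)$ be the least size of a set $S\subseteq V(G)$ such that $G-S$ is disconnected or trivial (a single vertex). For $S\subseteq V(G)$, an $S$-tree is a subgraph of $G$ that is a tree and contains all vertices of $S$; $S$-trees $T_1,\dots,T_r$ are internally disjoint if $E(T_i)\cap E(T_j)=\emptyset$ and $V(T_i)\cap V(T_j)=S$ for all $i\neq j$; $\kappa(S)$ is the greatest number of internally disjoint $S$-trees in $G$. Let $\kappa_3(G)=\min\{\kappa(S) : S\subseteq V(G),\ |S|=3\}$ if $|V(G)|\ge 3$, and $\kappa_3(G)=1$ if $G$ is connected with fewer than three vertices. Let $G\Box T$ denote the Cartesian product. **Theorem 4.1.** Let $G$ be a connected graph and $T$ a tree. (i) If $\kappa_3(G)=\kappa(G)\ge 1$, then $\kappa_3(G\Box T)\ge\kappa_3(G)$. The bound is sharp: for every integer $k\ge 1$ there are a connected graph $G$ and a tree $T$ with at least two vertices such that $\kappa_3(G)=\kappa(G)=k$ and $\kappa_3(G\Box T)=k$. (ii) If $1\le\kappa_3(G)<\kappa(G)$ and $T$ has at least two vertices, then $\kappa_3(G\Box T)\ge\kappa_3(G)+1$.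 The bound is sharp: for every integer $k\ge 1$ there are a connected graph $G$ and a tree $T$ with at least two vertices such that $\kappa_3(G)=k<\kappa(G)$ and $\kappa_3(G\Box T)=k+1$. -/

import Mathlib

namespace SimpleGraph

variable {V : Type*}

/-- The connectivity `κ(G)` of a finite graph: the least number of vertices whose removal leaves
a graph that is disconnected or trivial. (The removal of all vertices is also admitted here; this
does not change the minimum for a nonempty graph, since leaving one vertex costs less.) -/
noncomputable def vertexConnectivity (G : SimpleGraph V) : ℕ :=
  sInf {n | ∃ S : Finset V, S.card = n ∧
    (¬ (G.induce ((S : Set V)ᶜ)).Preconnected ∨ ((S : Set V)ᶜ).Subsingleton)}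

/-- An `S`-tree of `G`: a subgraph of `G` that is a tree and contains all vertices of `S`. -/
def IsSteinerTree (G : SimpleGraph V) (S : Finset V) (T : G.Subgraph) : Prop :=
  T.coe.IsTree ∧ (S : Set V) ⊆ T.verts

/-- The family `T` consists of internally disjoint `S`-trees: any two members have no common edge,
and their common vertices are exactly those of `S`. -/
def IsInternallyDisjointSteinerTrees (G : SimpleGraph V) (S : Finset V) {r : ℕ}
    (T : Fin r → G.Subgraph) : Prop :=
  (∀ i, G.IsSteinerTree S (T i)) ∧
    ∀ i j, i ≠ j → (T i).edgeSet ∩ (T j).edgeSet = ∅ ∧ (T i).verts ∩ (T j).verts = (S : Set V)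

/-- `κ(S)`: the greatest number of internally disjoint `S`-trees in the finite graph `G`
(for `S` with at least two vertices this is a maximum, see `bddAbove_steinerTrees`). -/
noncomputable def steinerConnectivity (G : SimpleGraph V) (S : Finset V) : ℕ :=
  sSup {r | ∃ T : Fin r → G.Subgraph, G.IsInternallyDisjointSteinerTrees S T}

/-- The sizes of families of internally disjoint `S`-trees are bounded when `2 ≤ |S|`. -/
theorem bddAbove_steinerTrees [Finite V] (G : SimpleGraph V) (S : Finset V) (hS : 2 ≤ S.card) :
    BddAbove {r | ∃ T : Fin r → G.Subgraph, G.IsInternallyDisjointSteinerTrees S T} := by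
  refine ⟨Nat.card (Sym2 V), ?_⟩
  rintro r ⟨T, hT, hd⟩
  have hne : ∀ i, ∃ e, e ∈ (T i).edgeSet := by
    intro i
    obtain ⟨a, ha, b, hb, hab⟩ := Finset.one_lt_card.mp hS
    have hnt : Nontrivial (T i).verts :=
      ⟨⟨a, (hT i).2 ha⟩, ⟨b, (hT i).2 hb⟩, fun h => hab (congrArg Subtype.val h)⟩
    obtain ⟨c, hc⟩ := (hT i).1.1.preconnected.exists_adj_of_nontrivial ⟨a, (hT i).2 ha⟩
    exact ⟨s(a, c.1), by simpa using hc⟩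
  choose e he using hne
  have hinj : Function.Injective e := by
    intro i j hij
    by_contra hne
    have h : e i ∈ (T i).edgeSet ∩ (T j).edgeSet := ⟨he i, hij ▸ he j⟩
    rw [(hd i j hne).1] at h
    exact h
  simpa using Nat.card_le_card_of_injective e hinj

open Classical in
/-- The generalized `k`-connectivity `κ_k(G)` of a finite graph, for `2 ≤ k`: the minimum of
`κ(S)` over all vertex sets `S` with `|S| = k`. By convention a connected graph with fewer than
`k` vertices has `κ_k(G) = 1` (and a disconnected one has `κ_k(G) = 0`). -/
noncomputable def generalizedConnectivity (k : ℕ) (G : SimpleGraph V) : ℕ :=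
  if Nat.card V < k then (if G.Connected then 1 else 0)
  else sInf {n | ∃ S : Finset V, S.card = k ∧ G.steinerConnectivity S = n}

end SimpleGraph

/-!
The lower bounds rest on one statement: if `κ(G) ≥ k + 1`, every three vertices of `G` are joined by
`k` internally disjoint trees, and `H` is connected and nontrivial, then every three vertices of
`G □ H` are joined by `k + 1` internally disjoint trees
(`add_one_le_generalizedConnectivity_boxProd`). The second bound is this statement itself. The first
one is the case `k = κ(G) - 1` if `T` has an edge, and is trivial otherwise.

Connected subgraphs can replace trees (`IsPacking`). Most of the subgraphs used are combs
(`combSubgraph`): a column `{v} × H` together with a connected subgraph through `v` in each fibre.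
Combs with distinct `v`'s are disjoint once their parts in every fibre are
(`exists_isPacking_boxProd`), so it suffices to choose `k + 1` distinct vertices of `G` and
to solve a problem in each fibre.

* If the three vertices lie in different fibres, then any `k + 1` vertices of `G` will do; in each
  of the three fibres the fan lemma joins the vertex there to all of them.
* If exactly two of them, `x` and `y`, lie in one fibre, then Menger's theorem gives `k + 1`
  internally disjoint paths from `x` to `y`, one vertex is marked on each, and a fan joins the third
  vertex to the marked ones.
* If all three lie in one fibre, then `k` trees are found there, and one more runs through an
  adjacent fibre.

Menger's theorem is proved in the form of `exists_disjoint_connections`, by Göring's induction on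
the edges.

For sharpness, two adjacent vertices of degree at most `d + 1` force `κ₃ ≤ d`
(`generalizedConnectivity_three_le_of_adj`), and a vertex of degree `d` in `G` gives two such
vertices in `G □ K₂`. The second bound is attained by the complete graph on `k + 2` vertices, the
first one by a large complete graph with one further vertex of degree `k` (`attachedVertexGraph`).
-/

namespace SimpleGraph

/-! ### Packings of connected subgraphs -/

section Packing

variable {V W : Type*}

/-- A family of connected subgraphs of `G` each of which contains `R`, and which pairwise share no
edge and no vertex outside `R`. Passing to spanning trees turns such a family into internally
disjoint `R`-trees. -/
structure IsPacking (G : SimpleGraph V) (R : Set V) {ι : Type*} (C : ι → G.Subgraph) : Prop where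
  connected : ∀ i, (C i).Connected
  subset : ∀ i, R ⊆ (C i).verts
  verts_inter : ∀ i j, i ≠ j → ∀ v, v ∈ (C i).verts → v ∈ (C j).verts → v ∈ R
  not_adj : ∀ i j, i ≠ j → ∀ u v, (C i).Adj u v → ¬ (C j).Adj u v

lemma Subgraph.Connected.exists_isTree_le {G : SimpleGraph V} {C : G.Subgraph} (hC : C.Connected) :
    ∃ D ≤ C, D.verts = C.verts ∧ D.coe.IsTree := by
  obtain ⟨T, hle, hT⟩ := SimpleGraph.Connected.exists_isTree_le hC.coe
  refine ⟨⟨C.verts, fun u v => ∃ (hu : u ∈ C.verts) (hv : v ∈ C.verts), T.Adj ⟨u, hu⟩ ⟨v, hv⟩,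
    ?_, ?_, ?_⟩, ⟨le_rfl, ?_⟩, rfl, ?_⟩
  · rintro u v ⟨hu, hv, h⟩
    exact C.adj_sub (hle h)
  · rintro u v ⟨hu, hv, h⟩
    exact hu
  · exact ⟨fun u v ⟨hu, hv, h⟩ => ⟨hv, hu, h.symm⟩⟩
  · rintro u v ⟨hu, hv, h⟩
    exact hle h
  · convert hT
    ext ⟨u, hu⟩ ⟨v, hv⟩
    exact ⟨fun ⟨_, _, h⟩ => h, fun h => ⟨hu, hv, h⟩⟩

lemma IsPacking.card_le_steinerConnectivity [Finite V] {G : SimpleGraph V} {S : Finset V}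
    (hS : 2 ≤ S.card) {ι : Type*} [Finite ι] {C : ι → G.Subgraph} (hC : G.IsPacking S C) :
    Nat.card ι ≤ G.steinerConnectivity S := by
  choose D hDC hDv hDT using fun i => (hC.connected i).exists_isTree_le
  refine le_csSup (bddAbove_steinerTrees G S hS) ⟨fun i => D ((Finite.equivFin ι).symm i), ?_, ?_⟩
  · intro i
    exact ⟨hDT _, by rw [hDv]; exact hC.subset _⟩
  · intro i j hij
    have hij' := (Finite.equivFin ι).symm.injective.ne hij
    constructor
    · ext e
      induction e with
      | _ u v =>
        simp only [Set.mem_inter_iff, Subgraph.mem_edgeSet, Set.mem_empty_iff_false, iff_false]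
        exact fun h => hC.not_adj _ _ hij' u v ((hDC _).2 h.1) ((hDC _).2 h.2)
    · ext u
      rw [hDv, hDv]
      exact ⟨fun h => hC.verts_inter _ _ hij' u h.1 h.2, fun h => ⟨hC.subset _ h, hC.subset _ h⟩⟩

lemma exists_isPacking_of_le_steinerConnectivity [Finite V] {G : SimpleGraph V} {S : Finset V}
    (hS : 2 ≤ S.card) {r : ℕ} (hr : r ≤ G.steinerConnectivity S) :
    ∃ C : Fin r → G.Subgraph, G.IsPacking S C := by
  obtain ⟨T, hT, hd⟩ := Nat.sSup_mem
    (s := {r | ∃ T : Fin r → G.Subgraph, G.IsInternallyDisjointSteinerTrees S T})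
    ⟨0, fun i => i.elim0, fun i => i.elim0, fun i => i.elim0⟩ (bddAbove_steinerTrees G S hS)
  refine ⟨fun i => T (Fin.castLE hr i), fun i => ⟨(hT _).1.1⟩, fun i => (hT _).2, ?_, ?_⟩
  · intro i j hij v hi hj
    have := (hd _ _ ((Fin.castLE_injective hr).ne hij)).2
    exact this.subset ⟨hi, hj⟩
  · intro i j hij u v hi hj
    have := (hd _ _ ((Fin.castLE_injective hr).ne hij)).1
    exact Set.eq_empty_iff_forall_notMem.1 this s(u, v) ⟨hi, hj⟩

lemma IsPacking.map {G : SimpleGraph V} {G' : SimpleGraph W} (f : G →g G')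
    (hf : Function.Injective f) {R : Set V} {ι : Type*} {C : ι → G.Subgraph}
    (hC : G.IsPacking R C) : G'.IsPacking (f '' R) fun i => (C i).map f where
  connected i := by
    have h := (hC.connected i).coe
    refine ⟨?_⟩
    let g : (C i).coe →g ((C i).map f).coe :=
      ⟨fun u => ⟨f u.1, u.1, u.2, rfl⟩, fun {u v} h => ⟨u.1, v.1, h, rfl, rfl⟩⟩
    refine h.map g ?_
    rintro ⟨_, u, hu, rfl⟩
    exact ⟨⟨u, hu⟩, rfl⟩
  subset i := Set.image_mono (hC.subset i)
  verts_inter := by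
    rintro i j hij _ ⟨u, hu, rfl⟩ ⟨v, hv, hvu⟩
    obtain rfl := hf hvu
    exact ⟨_, hC.verts_inter i j hij _ hu hv, rfl⟩
  not_adj := by
    rintro i j hij _ _ ⟨u, v, huv, rfl, rfl⟩ ⟨u', v', huv', h1, h2⟩
    obtain rfl := hf h1
    obtain rfl := hf h2
    exact hC.not_adj i j hij _ _ huv huv'

lemma IsPacking.comp {G : SimpleGraph V} {R : Set V} {ι κ : Type*} {C : ι → G.Subgraph}
    (hC : G.IsPacking R C) {f : κ → ι} (hf : Function.Injective f) :
    G.IsPacking R fun i => C (f i) where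
  connected _ := hC.connected _
  subset _ := hC.subset _
  verts_inter _ _ hij := hC.verts_inter _ _ (hf.ne hij)
  not_adj _ _ hij := hC.not_adj _ _ (hf.ne hij)

lemma IsPacking.option {G : SimpleGraph V} {R : Set V} {ι : Type*} {C : ι → G.Subgraph}
    (hC : G.IsPacking R C) {D : G.Subgraph} (hD : D.Connected) (hR : R ⊆ D.verts)
    (hv : ∀ i v, v ∈ D.verts → v ∈ (C i).verts → v ∈ R)
    (ha : ∀ i u v, D.Adj u v → ¬ (C i).Adj u v) :
    G.IsPacking R fun o : Option ι => o.elim D C := by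
  refine ⟨?_, ?_, ?_, ?_⟩
  · rintro (_ | i)
    exacts [hD, hC.connected i]
  · rintro (_ | i)
    exacts [hR, hC.subset i]
  · rintro (_ | i) (_ | j) hij v h1 h2
    exacts [absurd rfl hij, hv j v h1 h2, hv i v h2 h1,
      hC.verts_inter i j (fun h => hij (h ▸ rfl)) v h1 h2]
  · rintro (_ | i) (_ | j) hij u v h1 h2
    exacts [hij rfl, ha j u v h1 h2, ha i u v h2 h1,
      hC.not_adj i j (fun h => hij (h ▸ rfl)) u v h1 h2]

/-- In `G □ H`, the subgraph made of a copy of `K w` in the fibre over each `w`, with the fibres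
joined along the column of the vertex `v`. -/
def combSubgraph (G : SimpleGraph V) (H : SimpleGraph W) (v : V) (K : W → G.Subgraph)
    (hv : ∀ w, v ∈ (K w).verts) : (G □ H).Subgraph where
  verts := {p | p.1 ∈ (K p.2).verts}
  Adj p q := (p.2 = q.2 ∧ (K p.2).Adj p.1 q.1) ∨ (p.1 = v ∧ q.1 = v ∧ H.Adj p.2 q.2)
  adj_sub := by
    rintro ⟨p, w⟩ ⟨q, w'⟩ (⟨h1, h2⟩ | ⟨h1, h2, h3⟩)
    · exact boxProd_adj.2 (Or.inl ⟨(K w).adj_sub h2, h1⟩)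
    · exact boxProd_adj.2 (Or.inr ⟨h3, h1.trans h2.symm⟩)
  edge_vert := by
    rintro ⟨p, w⟩ ⟨q, w'⟩ (⟨h1, h2⟩ | ⟨h1, h2, h3⟩)
    · exact (K w).edge_vert h2
    · obtain rfl : p = v := h1
      exact hv w
  symm := by
    refine ⟨?_⟩
    rintro ⟨p, w⟩ ⟨q, w'⟩ (⟨h1, h2⟩ | ⟨h1, h2, h3⟩)
    · obtain rfl : w = w' := h1
      exact Or.inl ⟨rfl, h2.symm⟩
    · exact Or.inr ⟨h2, h1, h3.symm⟩

lemma connected_combSubgraph {G : SimpleGraph V} {H : SimpleGraph W} (hH : H.Connected) {v : V}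
    {K : W → G.Subgraph} (hv : ∀ w, v ∈ (K w).verts) (hK : ∀ w, (K w).Connected) :
    (combSubgraph G H v K hv).Connected := by
  obtain ⟨w₀⟩ := hH.nonempty
  let f (w : W) : (K w).coe →g (combSubgraph G H v K hv).coe :=
    ⟨fun u => ⟨(u.1, w), u.2⟩, fun h => Or.inl ⟨rfl, h⟩⟩
  let g : H →g (combSubgraph G H v K hv).coe :=
    ⟨fun w => ⟨(v, w), hv w⟩, fun h => Or.inr ⟨rfl, rfl, h⟩⟩
  refine ⟨(connected_iff_exists_forall_reachable _).2 ⟨g w₀, ?_⟩⟩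
  rintro ⟨⟨u, w⟩, hu⟩
  exact ((hH.preconnected w₀ w).map g).trans (((hK w).preconnected ⟨v, hv w⟩ ⟨u, hu⟩).map (f w))

/-- Packings of `{u | (u, w) ∈ S}` in the fibres, all with the same distinct marked vertices `v i`,
glue along the columns of the marked vertices to a packing of `S` in `G □ H`. -/
lemma exists_isPacking_boxProd {G : SimpleGraph V} {H : SimpleGraph W} (hH : H.Connected)
    {S : Set (V × W)} {ι : Type*} {v : ι → V} (hv : Function.Injective v)
    (h : ∀ w, ∃ K : ι → G.Subgraph, G.IsPacking {u | (u, w) ∈ S} K ∧ ∀ i, v i ∈ (K i).verts) :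
    ∃ C : ι → (G □ H).Subgraph, (G □ H).IsPacking S C := by
  choose K hK hvK using h
  refine ⟨fun i => combSubgraph G H (v i) (fun w => K w i) (fun w => hvK w i), ?_, ?_, ?_, ?_⟩
  · exact fun i => connected_combSubgraph hH _ fun w => (hK w).connected i
  · rintro i ⟨u, w⟩ hu
    exact (hK w).subset i hu
  · rintro i j hij ⟨u, w⟩ hi hj
    exact (hK w).verts_inter i j hij u hi hj
  · rintro i j hij ⟨u, w⟩ ⟨u', w'⟩ (⟨h1, h2⟩ | ⟨h1, h2, h3⟩) (⟨h4, h5⟩ | ⟨h4, h5, h6⟩)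
    · exact (hK w).not_adj i j hij _ _ h2 h5
    · exact h6.ne h1
    · exact h3.ne h4
    · exact hij (hv (h1.symm.trans h4))

lemma isPacking_singletonSubgraph (G : SimpleGraph V) {ι : Type*} {v : ι → V}
    (hv : Function.Injective v) : G.IsPacking ∅ fun i => G.singletonSubgraph (v i) where
  connected _ := Subgraph.singletonSubgraph_connected
  subset _ := Set.empty_subset _
  verts_inter i j hij u hi hj := hij (hv (by
    rw [← Set.mem_singleton_iff.1 hi, ← Set.mem_singleton_iff.1 hj]))
  not_adj _ _ _ _ _ h := h.elim

end Packing

/-! ### Menger's theorem -/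

section Menger

variable {V : Type*}

/-- `v` can be reached from `u` by a walk of `G` none of whose vertices, ends included, is in
`X`. -/
def ReachableAvoiding (G : SimpleGraph V) (X : Set V) (u v : V) : Prop :=
  ∃ p : G.Walk u v, ∀ w ∈ p.support, w ∉ X

namespace ReachableAvoiding

variable {G H : SimpleGraph V} {X Y : Set V} {u v w : V}

lemma refl (hu : u ∉ X) : G.ReachableAvoiding X u u := ⟨Walk.nil, by simpa using hu⟩

lemma symm (h : G.ReachableAvoiding X u v) : G.ReachableAvoiding X v u := by
  obtain ⟨p, hp⟩ := h
  exact ⟨p.reverse, by simpa using hp⟩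

lemma trans (h : G.ReachableAvoiding X u v) (h' : G.ReachableAvoiding X v w) :
    G.ReachableAvoiding X u w := by
  obtain ⟨p, hp⟩ := h
  obtain ⟨q, hq⟩ := h'
  refine ⟨p.append q, fun z hz => ?_⟩
  rcases (Walk.mem_support_append_iff _ _).1 hz with hz | hz
  exacts [hp z hz, hq z hz]

lemma mono (hGH : G ≤ H) (hXY : Y ⊆ X) (h : G.ReachableAvoiding X u v) :
    H.ReachableAvoiding Y u v := by
  obtain ⟨p, hp⟩ := h
  exact ⟨p.mapLe hGH, fun z hz => fun hzY => hp z (by simpa using hz) (hXY hzY)⟩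

lemma left_notMem (h : G.ReachableAvoiding X u v) : u ∉ X := by
  obtain ⟨p, hp⟩ := h
  exact hp u p.start_mem_support

lemma right_notMem (h : G.ReachableAvoiding X u v) : v ∉ X := h.symm.left_notMem

lemma of_adj (h : G.Adj u v) (hu : u ∉ X) (hv : v ∉ X) : G.ReachableAvoiding X u v :=
  ⟨h.toWalk, by simp [hu, hv]⟩

lemma exists_adj_of_notMem (h : G.ReachableAvoiding X u v) {R : Set V} (hu : u ∈ R) (hv : v ∉ R) :
    ∃ a b, a ∈ R ∧ b ∉ R ∧ G.Adj a b ∧ a ∉ X ∧ b ∉ X := by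
  obtain ⟨p, hp⟩ := h
  induction p with
  | nil => exact absurd hu hv
  | cons hadj q ih =>
    rename_i a b c
    simp only [Walk.support_cons, List.mem_cons, forall_eq_or_imp] at hp
    by_cases hb : b ∈ R
    · exact ih hb hv hp.2
    · exact ⟨a, b, hu, hb, hadj, hp.1, hp.2 _ q.start_mem_support⟩

/-- A path from `u` to `v` avoiding `X`, as the set of its vertices. -/
lemma exists_path (h : G.ReachableAvoiding X u v) :
    ∃ D : Set V, Disjoint D X ∧ G.ReachableAvoiding Dᶜ u v ∧
      ∀ w ∈ D, w ≠ v → G.ReachableAvoiding (Dᶜ ∪ {v}) u w := by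
  classical
  obtain ⟨p, hp⟩ := h
  refine ⟨{w | w ∈ p.bypass.support}, ?_, ⟨p.bypass, by simp⟩, ?_⟩
  · exact Set.disjoint_left.2 fun w hw => hp w (p.support_bypass_subset_support hw)
  · intro w hw hwv
    refine ⟨p.bypass.takeUntil w hw, fun z hz => ?_⟩
    rintro (h | rfl)
    · exact h (Walk.support_takeUntil_subset_support _ _ hz)
    · exact Walk.endpoint_notMem_support_takeUntil p.bypass_isPath hw hwv.symm hz

end ReachableAvoiding

variable {G H : SimpleGraph V} {A B : Set V} {k : ℕ}

/-- Disjoint `A`-`P` connections, as many as `P` has vertices, contain disjoint paths that meet `P`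
only in their last vertices, indexed here by these. -/
lemma exists_paths_indexed_by_ends {P : Finset V} (hP : P.card = k) {C : Fin k → Set V}
    (hC : ∀ i, ∃ a ∈ A, ∃ p ∈ P, H.ReachableAvoiding (C i)ᶜ a p)
    (hd : ∀ i j, i ≠ j → Disjoint (C i) (C j)) :
    ∃ D : V → Set V, (∀ p ∈ P, ∃ a ∈ A, H.ReachableAvoiding (D p)ᶜ a p) ∧
      (∀ p ∈ P, ∀ q ∈ P, p ≠ q → Disjoint (D p) (D q)) ∧
      ∀ p ∈ P, ∀ v ∈ D p, v ≠ p → ∃ a ∈ A, H.ReachableAvoiding P a v := by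
  choose a ha b hb hab using hC
  have hbC (i) : b i ∈ C i := not_not.1 (hab i).right_notMem
  have hinj : Function.Injective b := fun i j hij => by
    by_contra hne
    exact Set.disjoint_left.1 (hd i j hne) (hbC i) (hij ▸ hbC j)
  have hsurj : ∀ p ∈ P, ∃ i, b i = p := by
    have := Finset.surj_on_of_inj_on_of_card_le (s := Finset.univ) (t := P) (fun i _ => b i)
      (fun i _ => hb i) (fun i j _ _ h => hinj h) (by simp [hP])
    exact fun p hp => by obtain ⟨i, _, hi⟩ := this p hp; exact ⟨i, hi.symm⟩
  choose D hDC hDab hD using fun i => (hab i).exists_path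
  have hDC' (i) : D i ⊆ C i := by simpa [Set.disjoint_compl_right_iff_subset] using hDC i
  rcases P.eq_empty_or_nonempty with rfl | ⟨p₀, hp₀⟩
  · exact ⟨fun _ => ∅, by simp, by simp, by simp⟩
  have : Nonempty (Fin k) := ⟨(hsurj p₀ hp₀).choose⟩
  choose! f hf using hsurj
  refine ⟨fun p => D (f p), ?_, ?_, ?_⟩
  · intro p hp
    refine ⟨a (f p), ha _, ?_⟩
    have := hDab (f p)
    rwa [hf p hp] at this
  · intro p hp q hq hpq
    have hne : f p ≠ f q := fun h => hpq (by rw [← hf p hp, ← hf q hq, h])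
    exact (hd _ _ hne).mono (hDC' _) (hDC' _)
  · intro p hp v hv hvp
    refine ⟨a (f p), ha _, (hD (f p) v hv (by rwa [hf p hp])).mono le_rfl ?_⟩
    intro q hq
    by_cases hqp : q = p
    · right
      rw [hf p hp]
      exact hqp
    · left
      intro hqD
      have hne : f p ≠ f q := fun h => hqp (by rw [← hf p hp, ← hf q hq, h])
      have hqC := hbC (f q)
      rw [hf q hq] at hqC
      exact Set.disjoint_left.1 (hd _ _ hne) (hDC' _ hqD) hqC

/-- Let `S` separate `A` from `B` in `H`, which lacks only the edge `xy` of `G`, with `y` on the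
side of `B`. Then no set of fewer than `k` vertices separates `A` from `S ∪ {x}` in `H`, if none
separates `A` from `B` in `G`. -/
lemma exists_reachableAvoiding_insert [DecidableEq V] {S : Finset V} {x y : V}
    (h : ∀ X : Finset V, X.card < k → ∃ a ∈ A, ∃ b ∈ B, G.ReachableAvoiding X a b)
    (hS : ∀ a ∈ A, ∀ b ∈ B, ¬ H.ReachableAvoiding S a b)
    (hy : ∃ b ∈ B, H.ReachableAvoiding S b y)
    (hGH : ∀ u v, G.Adj u v → ¬ H.Adj u v → s(u, v) = s(x, y)) (X : Finset V) (hX : X.card < k) :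
    ∃ a ∈ A, ∃ p ∈ insert x S, H.ReachableAvoiding X a p := by
  by_contra! hcon
  obtain ⟨a, ha, b, hb, hab⟩ := h X hX
  have hsub : (S : Set V) ⊆ (X : Set V) ∪ (insert x S : Finset V) := by
    intro z hz; right; simp [Finset.mem_coe.1 hz]
  obtain ⟨u, v, ⟨a', ha', hu⟩, hv, huv, huX, hvX⟩ := hab.exists_adj_of_notMem
    (R := {v | ∃ a ∈ A, H.ReachableAvoiding ((X : Set V) ∪ (insert x S : Finset V)) a v})
    ⟨a, ha, .refl (by
      rintro (h | h)
      · exact hab.left_notMem h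
      · exact hcon a ha a h (.refl hab.left_notMem))⟩
    (fun ⟨a', ha', h'⟩ => hS a' ha' b hb (h'.mono le_rfl hsub))
  by_cases hH : H.Adj u v
  · by_cases hvP : v ∈ insert x S
    · exact hcon a' ha' v hvP ((hu.mono le_rfl Set.subset_union_left).trans (.of_adj hH huX hvX))
    · refine hv ⟨a', ha', hu.trans (.of_adj hH hu.right_notMem ?_)⟩
      rintro (h | h)
      exacts [hvX h, hvP h]
  · rcases Sym2.eq_iff.1 (hGH u v huv hH) with ⟨rfl, rfl⟩ | ⟨rfl, rfl⟩
    · exact hu.right_notMem (Or.inr (by simp))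
    · obtain ⟨b', hb', hy⟩ := hy
      exact hS a' ha' b' hb' ((hu.mono le_rfl hsub).trans hy.symm)

/-- The edge across which a separator `S` of `H` fails to separate `A` from `B` in `G`. -/
lemma exists_edge_across {S : Set V} {e : Sym2 V}
    (hS : ∀ a ∈ A, ∀ b ∈ B, ¬ H.ReachableAvoiding S a b)
    (hG : ∃ a ∈ A, ∃ b ∈ B, G.ReachableAvoiding S a b)
    (hGH : ∀ u v, G.Adj u v → ¬ H.Adj u v → s(u, v) = e) :
    ∃ x y, s(x, y) = e ∧ (∃ a ∈ A, H.ReachableAvoiding S a x) ∧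
      ∃ b ∈ B, H.ReachableAvoiding S b y := by
  obtain ⟨a, ha, b, hb, hab⟩ := hG
  have key : ∀ (A' : Set V), ∀ u v : V, u ∈ A' → (∀ a ∈ A', ¬ H.ReachableAvoiding S a v) →
      G.ReachableAvoiding S u v → ∃ x y, s(x, y) = e ∧ ∃ a ∈ A', H.ReachableAvoiding S a x := by
    intro A' u v hu hv huv
    obtain ⟨x, y, ⟨c, hc, hx⟩, hy, hxy, hxS, hyS⟩ := huv.exists_adj_of_notMem
      (R := {v | ∃ a ∈ A', H.ReachableAvoiding S a v}) ⟨u, hu, .refl huv.left_notMem⟩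
      (fun ⟨c, hc, h⟩ => hv c hc h)
    refine ⟨x, y, hGH x y hxy fun hH => hy ⟨c, hc, hx.trans (.of_adj hH hxS hyS)⟩, c, hc, hx⟩
  obtain ⟨x, y, hxy, c, hc, hx⟩ := key A a b ha (fun c hc => hS c hc b hb) hab
  obtain ⟨y', x', hyx', d, hd, hy⟩ := key B b a hb (fun c hc h => hS a ha c hc h.symm) hab.symm
  rcases Sym2.eq_iff.1 (hxy.trans hyx'.symm) with ⟨rfl, rfl⟩ | ⟨rfl, rfl⟩
  · exact absurd (hx.trans hy.symm) (hS c hc d hd)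
  · exact ⟨x, y, hxy, ⟨c, hc, hx⟩, ⟨d, hd, hy⟩⟩

/-- **Menger's theorem** for vertex sets: if no fewer than `k` vertices separate `A` from `B`, then
there are `k` disjoint sets each of which carries a walk from `A` to `B`. -/
theorem exists_disjoint_connections [Finite V] (G : SimpleGraph V) (A B : Set V) (k : ℕ)
    (h : ∀ X : Finset V, X.card < k → ∃ a ∈ A, ∃ b ∈ B, G.ReachableAvoiding X a b) :
    ∃ C : Fin k → Set V, (∀ i, ∃ a ∈ A, ∃ b ∈ B, G.ReachableAvoiding (C i)ᶜ a b) ∧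
      ∀ i j, i ≠ j → Disjoint (C i) (C j) := by
  classical
  -- Göring's induction on the edges: an edge can be deleted unless it joins the two sides of a
  -- separator with `k - 1` vertices.
  induction G using WellFoundedLT.induction generalizing A B with
  | ind G ih =>
  by_cases hG : ∃ x y, G.Adj x y
  · obtain ⟨x₀, y₀, hxy₀⟩ := hG
    set H := G.deleteEdges {s(x₀, y₀)} with hHdef
    have hlt : H < G := by
      refine lt_of_le_of_ne (deleteEdges_le _) fun heq => ?_
      have := heq ▸ hxy₀
      simp [hHdef] at this
    have hGH : ∀ u v, G.Adj u v → ¬ H.Adj u v → s(u, v) = s(x₀, y₀) := by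
      intro u v huv hH
      by_contra hne
      exact hH (by rw [hHdef, deleteEdges_adj]; exact ⟨huv, hne⟩)
    by_cases hH : ∀ X : Finset V, X.card < k → ∃ a ∈ A, ∃ b ∈ B, H.ReachableAvoiding X a b
    · obtain ⟨C, hC, hd⟩ := ih H hlt A B hH
      refine ⟨C, fun i => ?_, hd⟩
      obtain ⟨a, ha, b, hb, hab⟩ := hC i
      exact ⟨a, ha, b, hb, hab.mono hlt.le le_rfl⟩
    · push Not at hH
      obtain ⟨S, hSk, hS⟩ := hH
      obtain ⟨x, y, hxy, hx, hy⟩ := exists_edge_across hS (h S hSk) hGH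
      rw [← hxy] at hGH
      have hxS : x ∉ S := by obtain ⟨_, _, h⟩ := hx; exact h.right_notMem
      have hyS : y ∉ S := by obtain ⟨_, _, h⟩ := hy; exact h.right_notMem
      have hS' : ∀ b ∈ B, ∀ a ∈ A, ¬ H.ReachableAvoiding S b a :=
        fun b hb a ha h => hS a ha b hb h.symm
      have h' : ∀ X : Finset V, X.card < k → ∃ b ∈ B, ∃ a ∈ A, G.ReachableAvoiding X b a := by
        intro X hX
        obtain ⟨a, ha, b, hb, hab⟩ := h X hX
        exact ⟨b, hb, a, ha, hab.symm⟩
      have hcard : S.card + 1 = k := by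
        by_contra hne
        obtain ⟨a, ha, b, hb, hab⟩ := h (insert x S)
          (by rw [Finset.card_insert_of_notMem hxS]; omega)
        refine hS a ha b hb ?_
        by_contra hnot
        obtain ⟨u, v, hu, hv, huv, huP, hvP⟩ := hab.exists_adj_of_notMem
          (R := {v | H.ReachableAvoiding S a v})
          (.refl fun h => hab.left_notMem (Finset.mem_coe.2
            (Finset.mem_insert_of_mem (Finset.mem_coe.1 h)))) hnot
        have hnotS : ∀ z, z ∉ ((insert x S : Finset V) : Set V) → z ≠ x ∧ z ∉ S := by simp
        have hH : ¬ H.Adj u v := fun hH =>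
          hv (ReachableAvoiding.trans hu (.of_adj hH (hnotS u huP).2 (hnotS v hvP).2))
        rcases Sym2.eq_iff.1 (hGH u v huv hH) with ⟨h1, h2⟩ | ⟨h1, h2⟩
        exacts [(hnotS u huP).1 h1, (hnotS v hvP).1 h2]
      obtain ⟨C, hC, hCd⟩ := ih H hlt A (insert x S : Finset V)
        (exists_reachableAvoiding_insert h hS hy hGH)
      obtain ⟨C', hC', hCd'⟩ := ih H hlt B (insert y S : Finset V)
        (exists_reachableAvoiding_insert h' hS' hx
          fun u v huv hH => (hGH u v huv hH).trans Sym2.eq_swap)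
      obtain ⟨D, hD, hDd, hDA⟩ := exists_paths_indexed_by_ends
        (by rw [Finset.card_insert_of_notMem hxS, hcard]) hC hCd
      obtain ⟨E, hE, hEd, hEB⟩ := exists_paths_indexed_by_ends
        (by rw [Finset.card_insert_of_notMem hyS, hcard]) hC' hCd'
      -- The paths from `A` to `S ∪ {x}` continue with those from `S ∪ {y}` to `B`.
      let φ : V → V := fun p => if p = x then y else p
      have hφx : φ x = y := if_pos rfl
      have hφS : ∀ p ∈ S, φ p = p := fun p hp => if_neg fun h : p = x => hxS (h ▸ hp)
      have hφ : ∀ p ∈ insert x S, φ p ∈ insert y S := by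
        intro p hp
        rcases Finset.mem_insert.1 hp with rfl | hp
        · simp [hφx]
        · simp [hφS p hp, hp]
      have hφinj : ∀ p ∈ insert x S, ∀ q ∈ insert x S, p ≠ q → φ p ≠ φ q := by
        intro p hp q hq hpq
        rcases Finset.mem_insert.1 hp with rfl | hp' <;>
          rcases Finset.mem_insert.1 hq with rfl | hq'
        · exact absurd rfl hpq
        · rw [hφx, hφS q hq']; rintro rfl; exact hyS hq'
        · rw [hφx, hφS p hp']; rintro rfl; exact hyS hp'
        · rwa [hφS p hp', hφS q hq']
      have hcross : ∀ p ∈ insert x S, ∀ q ∈ insert x S, p ≠ q → Disjoint (D p) (E (φ q)) := by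
        intro p hp q hq hpq
        refine Set.disjoint_left.2 fun v hvD hvE => ?_
        by_cases hvS : v ∈ S
        · have hvP : v ∈ insert x S := Finset.mem_insert_of_mem hvS
          have hvDv : v ∈ D v := by
            obtain ⟨_, _, h⟩ := hD v hvP
            exact not_not.1 h.right_notMem
          have hvEv : v ∈ E (φ v) := by
            obtain ⟨_, _, h⟩ := hE (φ v) (hφ v hvP)
            rw [hφS v hvS] at h ⊢
            exact not_not.1 h.right_notMem
          by_cases hpv : p = v
          · have hqv : v ≠ q := hpv ▸ hpq
            exact Set.disjoint_left.1
              (hEd _ (hφ v hvP) _ (hφ q hq) (hφinj v hvP q hq hqv)) hvEv hvE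
          · exact Set.disjoint_left.1 (hDd p hp v hvP hpv) hvD hvDv
        · have hA : ∃ a ∈ A, H.ReachableAvoiding S a v := by
            by_cases hvp : v = p
            · obtain rfl : v = x := (Finset.mem_insert.1 (hvp ▸ hp)).resolve_right hvS
              exact hx
            · obtain ⟨a, ha, h⟩ := hDA p hp v hvD hvp
              exact ⟨a, ha, h.mono le_rfl (by simp)⟩
          have hB : ∃ b ∈ B, H.ReachableAvoiding S b v := by
            by_cases hvq : v = φ q
            · obtain rfl : v = y := (Finset.mem_insert.1 (hvq ▸ hφ q hq)).resolve_right hvS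
              exact hy
            · obtain ⟨b, hb, h⟩ := hEB (φ q) (hφ q hq) v hvE hvq
              exact ⟨b, hb, h.mono le_rfl (by simp)⟩
          obtain ⟨a, ha, hav⟩ := hA
          obtain ⟨b, hb, hbv⟩ := hB
          exact hS a ha b hb (hav.trans hbv.symm)
      have e : Fin k ≃ (insert x S : Finset V) :=
        (Finset.equivFinOfCardEq (by rw [Finset.card_insert_of_notMem hxS, hcard])).symm
      refine ⟨fun i => D (e i) ∪ E (φ (e i)), fun i => ?_, fun i j hij => ?_⟩
      · dsimp only
        generalize e i = s
        obtain ⟨p, hp⟩ := s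
        obtain ⟨a, ha, hap⟩ := hD p hp
        obtain ⟨b, hb, hbp⟩ := hE (φ p) (hφ p hp)
        have hpφ : G.ReachableAvoiding (D p ∪ E (φ p))ᶜ p (φ p) := by
          have h1 : p ∉ (D p ∪ E (φ p))ᶜ := by
            exact fun h => h (Or.inl (not_not.1 hap.right_notMem))
          have h2 : φ p ∉ (D p ∪ E (φ p))ᶜ := by
            exact fun h => h (Or.inr (not_not.1 hbp.right_notMem))
          rcases Finset.mem_insert.1 hp with rfl | hpS
          · refine .of_adj ?_ h1 h2
            rw [hφx]
            have : s(p, y) ∈ G.edgeSet := hxy ▸ hxy₀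
            exact this
          · rw [hφS p hpS] at h1 ⊢
            exact .refl h1
        refine ⟨a, ha, b, hb, (hap.mono hlt.le ?_).trans (hpφ.trans (hbp.symm.mono hlt.le ?_))⟩
        · exact Set.compl_subset_compl.2 Set.subset_union_left
        · exact Set.compl_subset_compl.2 Set.subset_union_right
      · have hne : ((e i : _) : V) ≠ e j := fun h => hij (e.injective (Subtype.ext h))
        rw [Set.disjoint_union_left, Set.disjoint_union_right, Set.disjoint_union_right]
        refine ⟨⟨hDd _ (e i).2 _ (e j).2 hne, hcross _ (e i).2 _ (e j).2 hne⟩,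
          (hcross _ (e j).2 _ (e i).2 hne.symm).symm, hEd _ (hφ _ (e i).2) _ (hφ _ (e j).2) ?_⟩
        exact hφinj _ (e i).2 _ (e j).2 hne
  · push Not at hG
    -- Without edges, the connections are the vertices of `A ∩ B`.
    have hcard : k ≤ (A ∩ B).toFinite.toFinset.card := by
      by_contra! hlt
      obtain ⟨a, ha, b, hb, hab⟩ := h _ hlt
      obtain rfl : a = b := by
        obtain ⟨p, _⟩ := hab
        cases p with
        | nil => rfl
        | cons hadj _ => exact absurd hadj (hG _ _)
      exact hab.left_notMem (by simp [ha, hb])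
    obtain ⟨P, hPsub, hPk⟩ := Finset.exists_subset_card_eq hcard
    have e : Fin k ≃ P := (Finset.equivFinOfCardEq hPk).symm
    refine ⟨fun i => {(e i : V)}, fun i => ?_, fun i j hij => ?_⟩
    · have := hPsub (e i).2
      rw [Set.Finite.mem_toFinset] at this
      exact ⟨e i, this.1, e i, this.2, .refl (by simp)⟩
    · exact Set.disjoint_singleton.2 fun h => hij (e.injective (Subtype.ext h))

end Menger

/-! ### Fans and internally disjoint paths -/

section Fans

variable {V : Type*} {G : SimpleGraph V}

lemma vertexConnectivity_le {S : Finset V}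
    (hS : ¬ (G.induce ((S : Set V)ᶜ)).Preconnected ∨ ((S : Set V)ᶜ).Subsingleton) :
    G.vertexConnectivity ≤ S.card :=
  Nat.sInf_le ⟨S, rfl, hS⟩

lemma le_vertexConnectivity [Finite V] {k : ℕ}
    (h : ∀ X : Finset V, X.card < k → (∀ u v, u ∉ X → v ∉ X → G.ReachableAvoiding X u v) ∧
      ∃ u v, u ∉ X ∧ v ∉ X ∧ u ≠ v) : k ≤ G.vertexConnectivity := by
  cases nonempty_fintype V
  refine le_csInf ⟨_, Finset.univ, rfl, Or.inr (by simp)⟩ ?_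
  rintro _ ⟨S, rfl, hS⟩
  by_contra! hlt
  obtain ⟨h1, u, v, hu, hv, huv⟩ := h S hlt
  rcases hS with hS | hS
  · refine hS fun a b => ?_
    obtain ⟨p, hp⟩ := h1 a.1 b.1 a.2 b.2
    exact ⟨p.induce _ hp⟩
  · exact huv (hS hu hv)

lemma reachableAvoiding_of_card_lt {X : Finset V} (hX : X.card < G.vertexConnectivity) {u v : V}
    (hu : u ∉ X) (hv : v ∉ X) : G.ReachableAvoiding X u v := by
  have hpre : (G.induce ((X : Set V)ᶜ)).Preconnected := by
    by_contra h
    exact hX.not_ge (vertexConnectivity_le (Or.inl h))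
  have key (a b : ((X : Set V)ᶜ : Set V)) (p : (G.induce ((X : Set V)ᶜ)).Walk a b) :
      G.ReachableAvoiding X a b := by
    induction p with
    | @nil a => exact .refl a.2
    | @cons a b c hadj _ ih =>
      have hab : G.Adj a b := hadj
      exact (ReachableAvoiding.of_adj hab a.2 b.2).trans ih
  exact key ⟨u, hu⟩ ⟨v, hv⟩ (hpre _ _).some

lemma connected_of_one_le_vertexConnectivity (h : 1 ≤ G.vertexConnectivity) : G.Connected := by
  have hX : (∅ : Finset V).card < G.vertexConnectivity := h
  have : ¬ (((∅ : Finset V) : Set V)ᶜ).Subsingleton :=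
    fun h => hX.not_ge (vertexConnectivity_le (Or.inr h))
  obtain ⟨u, -, v, -, -⟩ := Set.not_subsingleton_iff.1 this
  have : Nonempty V := ⟨u⟩
  refine ⟨fun u v => ?_⟩
  obtain ⟨p, -⟩ := reachableAvoiding_of_card_lt hX (u := u) (v := v) (by simp) (by simp)
  exact ⟨p⟩

lemma vertexConnectivity_lt_card [Finite V] (hV : Nonempty V) :
    G.vertexConnectivity < Nat.card V := by
  classical
  cases nonempty_fintype V
  obtain ⟨v⟩ := hV
  refine (vertexConnectivity_le (S := Finset.univ.erase v) (Or.inr ?_)).trans_lt ?_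
  · intro a ha b hb
    simp only [Finset.coe_erase, Finset.coe_univ, Set.mem_compl_iff, Set.mem_sdiff, Set.mem_univ,
      true_and, Set.mem_singleton_iff, not_not] at ha hb
    rw [ha, hb]
  · rw [Nat.card_eq_fintype_card]
    exact Finset.card_lt_univ_of_notMem (Finset.notMem_erase v _)

namespace ReachableAvoiding

variable {X D : Set V} {u v : V}

/-- A walk to `v` reaches a neighbour of `v` before it first visits `v`. -/
lemma exists_adj_last (h : G.ReachableAvoiding X u v) (huv : u ≠ v) :
    ∃ w, G.Adj w v ∧ G.ReachableAvoiding (X ∪ {v}) u w := by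
  obtain ⟨a, b, ha, hb, hab, _, hbX⟩ := h.exists_adj_of_notMem
    (R := {w | G.ReachableAvoiding (X ∪ {v}) u w}) (.refl (by simp [h.left_notMem, huv]))
    (fun h' => h'.right_notMem (by simp))
  by_cases hbv : b = v
  · exact ⟨a, hbv ▸ hab, ha⟩
  · exact absurd (ha.trans (.of_adj hab ha.right_notMem (by simp [hbX, hbv]))) hb

lemma exists_connected (h : G.ReachableAvoiding Dᶜ u v) :
    ∃ C : G.Subgraph, C.Connected ∧ C.verts ⊆ D ∧ G.ReachableAvoiding C.vertsᶜ u v := by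
  obtain ⟨p, hp⟩ := h
  refine ⟨p.toSubgraph, p.toSubgraph_connected, fun w hw => ?_, p, fun w hw => ?_⟩
  · exact not_not.1 (hp w (p.mem_verts_toSubgraph.1 hw))
  · exact fun h => h (p.mem_verts_toSubgraph.2 hw)

end ReachableAvoiding

/-- The fan lemma: from `z` to at most `κ(G)` vertices there are paths that meet only in `z`. -/
lemma exists_isPacking_singleton [Finite V] {ι : Type*} [Finite ι] {v : ι → V}
    (hv : Function.Injective v) (hι : Nat.card ι ≤ G.vertexConnectivity) (z : V) :
    ∃ K : ι → G.Subgraph, G.IsPacking {z} K ∧ ∀ i, v i ∈ (K i).verts := by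
  classical
  cases nonempty_fintype ι
  set B : Finset V := (Finset.univ.image v).erase z with hB
  have hvB (i : ι) (hi : v i ≠ z) : v i ∈ B := by simp [hB, hi]
  have hBk : B.card ≤ G.vertexConnectivity := by
    refine (Finset.card_erase_le.trans Finset.card_image_le).trans ?_
    rwa [Finset.card_univ, ← Nat.card_eq_fintype_card]
  obtain ⟨C, hC, hCd⟩ := exists_disjoint_connections G {a | G.Adj a z} B B.card (by
    intro X hX
    obtain ⟨b, hb, hbX⟩ := Finset.exists_mem_notMem_of_card_lt_card hX
    have hbz : b ≠ z := Finset.ne_of_mem_erase hb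
    have hlt : (X.erase z).card < G.vertexConnectivity :=
      (Finset.card_erase_le.trans_lt hX).trans_le hBk
    obtain ⟨a, haz, ha⟩ := (reachableAvoiding_of_card_lt hlt (u := b) (v := z)
      (fun h => hbX (Finset.mem_of_mem_erase h)) (Finset.notMem_erase _ _)).exists_adj_last hbz
    refine ⟨a, haz, b, hb, ha.symm.mono le_rfl fun w hw => ?_⟩
    by_cases hwz : w = z
    · exact Or.inr hwz
    · exact Or.inl (by simpa [hwz] using hw))
  obtain ⟨D, hD, hDd, -⟩ := exists_paths_indexed_by_ends rfl hC hCd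
  have hK : ∀ i, ∃ K : G.Subgraph, K.Connected ∧ z ∈ K.verts ∧ v i ∈ K.verts ∧
      K.verts ⊆ D (v i) ∪ {z} ∧ (v i = z → K = G.singletonSubgraph z) := by
    intro i
    by_cases hi : v i = z
    · exact ⟨G.singletonSubgraph z, Subgraph.singletonSubgraph_connected, by simp, by simp [hi],
        by simp, fun _ => rfl⟩
    · obtain ⟨a, haz, ha⟩ := hD _ (hvB i hi)
      have h1 : G.ReachableAvoiding (D (v i) ∪ {z})ᶜ z (v i) :=
        (ReachableAvoiding.of_adj haz.symm (by simp)
          (Set.notMem_compl_iff.2 (Or.inl (not_not.1 ha.left_notMem)))).trans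
          (ha.mono le_rfl (Set.compl_subset_compl.2 Set.subset_union_left))
      obtain ⟨K, hKc, hKs, hK⟩ := h1.exists_connected
      exact ⟨K, hKc, not_not.1 hK.left_notMem, not_not.1 hK.right_notMem, hKs,
        fun h => absurd h hi⟩
  choose K hKc hKz hKv hKs hKe using hK
  have hinter : ∀ i j, i ≠ j → ∀ u, u ∈ (K i).verts → u ∈ (K j).verts → u = z := by
    intro i j hij u hui huj
    by_cases hi : v i = z
    · rw [hKe i hi] at hui
      exact hui
    by_cases hj : v j = z
    · rw [hKe j hj] at huj
      exact huj
    rcases hKs i hui with hui | hui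
    · rcases hKs j huj with huj | huj
      · exact absurd huj (Set.disjoint_left.1 (hDd _ (hvB i hi) _ (hvB j hj) (hv.ne hij)) hui)
      · exact huj
    · exact hui
  refine ⟨K, ⟨hKc, fun i => by simpa using hKz i, hinter, fun i j hij a b ha hb => ?_⟩, hKv⟩
  exact ha.ne ((hinter i j hij a ha.fst_mem hb.fst_mem).trans
    (hinter i j hij b ha.snd_mem hb.snd_mem).symm)

/-- Menger's theorem for two nonadjacent vertices; the paths have marked internal vertices. -/
lemma exists_isPacking_pair_of_not_adj [Finite V] {x y : V} (hxy : x ≠ y) (hadj : ¬ G.Adj x y)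
    {k : ℕ} (h : ∀ X : Finset V, X.card < k → x ∉ X → y ∉ X → G.ReachableAvoiding X x y) :
    ∃ (v : Fin k → V) (K : Fin k → G.Subgraph), G.IsPacking {x, y} K ∧
      ∀ i, v i ∈ (K i).verts ∧ v i ≠ x ∧ v i ≠ y := by
  classical
  obtain ⟨D, hD, hDd⟩ := exists_disjoint_connections G {a | G.Adj a x} {a | G.Adj a y} k (by
    intro X hX
    have h1 := h ((X.erase x).erase y)
      ((Finset.card_erase_le.trans Finset.card_erase_le).trans_lt hX) (by simp) (by simp)
    obtain ⟨b, hby, hb⟩ := h1.exists_adj_last hxy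
    obtain ⟨a, hax, ha⟩ := hb.symm.exists_adj_last (by rintro rfl; exact hadj hby)
    refine ⟨a, hax, b, hby, ha.symm.mono le_rfl fun w hw => ?_⟩
    by_cases hwx : w = x
    · exact Or.inr hwx
    by_cases hwy : w = y
    · exact Or.inl (Or.inr hwy)
    · exact Or.inl (Or.inl (by simpa [hwx, hwy] using hw)))
  have hK : ∀ i, ∃ (K : G.Subgraph) (v : V), K.Connected ∧ x ∈ K.verts ∧ y ∈ K.verts ∧
      K.verts ⊆ D i ∪ {x, y} ∧ v ∈ K.verts ∧ v ≠ x ∧ v ≠ y := by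
    intro i
    obtain ⟨a, hax, b, hby, hab⟩ := hD i
    have hab' : G.ReachableAvoiding (D i ∪ {x, y})ᶜ a b :=
      hab.mono le_rfl (Set.compl_subset_compl.2 Set.subset_union_left)
    have h1 := (ReachableAvoiding.of_adj (Adj.symm hax) (by simp) hab'.left_notMem).trans
      (hab'.trans (ReachableAvoiding.of_adj hby hab'.right_notMem (by simp)))
    obtain ⟨K, hKc, hKs, hK⟩ := h1.exists_connected
    obtain ⟨x', v, hx', hv, hxv, _, hvK⟩ := hK.exists_adj_of_notMem (R := {x}) rfl hxy.symm
    obtain rfl : x' = x := hx'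
    refine ⟨K, v, hKc, not_not.1 hK.left_notMem, not_not.1 hK.right_notMem, hKs, not_not.1 hvK,
      hv, ?_⟩
    rintro rfl
    exact hadj hxv
  choose K v hKc hKx hKy hKs hvK hvx hvy using hK
  have hinter : ∀ i j, i ≠ j → ∀ u, u ∈ (K i).verts → u ∈ (K j).verts → u = x ∨ u = y := by
    intro i j hij u hui huj
    rcases hKs i hui with hui | hui
    · rcases hKs j huj with huj | huj
      · exact absurd huj (Set.disjoint_left.1 (hDd i j hij) hui)
      · exact huj
    · exact hui
  refine ⟨v, K, ⟨hKc, ?_, hinter, fun i j hij a b ha hb => ?_⟩, fun i => ⟨hvK i, hvx i, hvy i⟩⟩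
  · rintro i u (rfl | rfl)
    exacts [hKx i, hKy i]
  · have hG := (K i).adj_sub ha
    rcases hinter i j hij a ha.fst_mem hb.fst_mem with rfl | rfl <;>
      rcases hinter i j hij b ha.snd_mem hb.snd_mem with rfl | rfl
    exacts [hG.ne rfl, hadj hG, hadj hG.symm, hG.ne rfl]

lemma exists_isPacking_pair [Finite V] {x y : V} (hxy : x ≠ y) {k : ℕ}
    (hk : k + 1 ≤ G.vertexConnectivity) :
    ∃ (v : Fin (k + 1) → V) (K : Fin (k + 1) → G.Subgraph), Function.Injective v ∧
      G.IsPacking {x, y} K ∧ ∀ i, v i ∈ (K i).verts := by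
  classical
  by_cases hadj : G.Adj x y
  · -- The edge `xy` is one of the paths, with `x` as its marked vertex.
    set G' := G.deleteEdges {s(x, y)} with hG'
    have hle : G' ≤ G := deleteEdges_le _
    have hadj' : ¬ G'.Adj x y := by simp [hG']
    have hstep : ∀ (X : Finset V) (a b c : V), X.card < k → s(x, y) = s(b, c) → a ∉ X → b ∉ X →
        c ∉ X → a ≠ c → G'.ReachableAvoiding X a b := by
      intro X a b c hX hbc ha hb hc hac
      have hbc' : b ≠ c := by
        rintro rfl
        have h : s(x, y).IsDiag := hbc ▸ Sym2.mk_isDiag_iff.2 rfl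
        exact hxy h
      obtain ⟨p, hp⟩ := reachableAvoiding_of_card_lt (G := G) (X := insert c X) (u := a) (v := b)
        (by rw [Finset.card_insert_of_notMem hc]; omega) (by simp [ha, hac]) (by simp [hb, hbc'])
      refine ⟨p.toDeleteEdges _ ?_, ?_⟩
      · rintro e he rfl
        rw [hbc] at he
        exact hp c (p.snd_mem_support_of_mem_edges he) (by simp)
      · intro w hw hwX
        rw [Walk.toDeleteEdges, Walk.support_transfer] at hw
        exact hp w hw (by simp [Finset.mem_coe.1 hwX])
    obtain ⟨v, K, hK, hv⟩ := exists_isPacking_pair_of_not_adj hxy hadj' (k := k) (by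
      intro X hX hx hy
      obtain ⟨w, hw⟩ : ∃ w, w ∉ insert x (insert y X) := by
        cases nonempty_fintype V
        have h1 := vertexConnectivity_lt_card (G := G) ⟨x⟩
        rw [Nat.card_eq_fintype_card] at h1
        have h2 := Finset.card_insert_le x (insert y X)
        have h3 := Finset.card_insert_le y X
        obtain ⟨w, -, hw⟩ := Finset.exists_mem_notMem_of_card_lt_card
          (s := insert x (insert y X)) (t := Finset.univ) (by rw [Finset.card_univ]; omega)
        exact ⟨w, hw⟩
      simp only [Finset.mem_insert, not_or] at hw
      exact (hstep X w x y hX rfl hw.2.2 hx hy hw.2.1).symm.trans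
        (hstep X w y x hX Sym2.eq_swap hw.2.2 hy hx hw.1))
    have hK' := hK.map (Hom.ofLE hle) Function.injective_id
    have himage : (Hom.ofLE hle) '' {x, y} = ({x, y} : Set V) := Set.image_id _
    rw [himage] at hK'
    have hKo := hK'.option (D := G.subgraphOfAdj hadj) (Subgraph.subgraphOfAdj_connected hadj)
      subset_rfl (fun i u hu _ => hu) (by
        rintro i a b hab ⟨a', b', h, rfl, rfl⟩
        have hG := (K i).adj_sub h
        rcases Sym2.eq_iff.1 (show s(x, y) = s(a', b') from hab) with ⟨rfl, rfl⟩ | ⟨rfl, rfl⟩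
        exacts [hadj' hG, hadj' hG.symm])
    have hvo : Function.Injective fun o : Option (Fin k) => o.elim x v := by
      rintro (_ | i) (_ | j) hij
      · rfl
      · exact absurd hij.symm (hv j).2.1
      · exact absurd hij (hv i).2.1
      · by_contra hne
        have hne' : i ≠ j := fun h => hne (h ▸ rfl)
        have hij' : v i = v j := hij
        rcases hK.verts_inter i j hne' (v i) (hv i).1 (hij' ▸ (hv j).1) with h | h
        exacts [(hv i).2.1 h, (hv i).2.2 h]
    have e : Fin (k + 1) ≃ Option (Fin k) := finSuccEquiv k
    refine ⟨_, _, hvo.comp e.injective, hKo.comp e.injective, fun i => ?_⟩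
    generalize hs : e i = s
    simp only [Function.comp, hs]
    rcases s with _ | i
    · simp
    · exact ⟨v i, (hv i).1, rfl⟩
  · obtain ⟨v, K, hK, hv⟩ := exists_isPacking_pair_of_not_adj hxy hadj (k := k + 1)
      fun X hX hx hy => reachableAvoiding_of_card_lt (by omega) hx hy
    refine ⟨v, K, fun i j hij => ?_, hK, fun i => (hv i).1⟩
    by_contra hne
    rcases hK.verts_inter i j hne (v i) (hv i).1 (hij ▸ (hv j).1) with h | h
    exacts [(hv i).2.1 h, (hv i).2.2 h]

end Fans

/-! ### The lower bound for Cartesian products -/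

section BoxProd

variable {V W : Type*}

lemma le_generalizedConnectivity_three [Finite V] {G : SimpleGraph V} {k : ℕ}
    (hV : 3 ≤ Nat.card V) (h : ∀ S : Finset V, S.card = 3 → k ≤ G.steinerConnectivity S) :
    k ≤ G.generalizedConnectivity 3 := by
  cases nonempty_fintype V
  rw [generalizedConnectivity, if_neg (by omega)]
  rw [Nat.card_eq_fintype_card] at hV
  obtain ⟨S, -, hS⟩ := Finset.exists_subset_card_eq (s := (Finset.univ : Finset V)) (n := 3) hV
  refine le_csInf ⟨_, S, hS, rfl⟩ ?_
  rintro _ ⟨S, hS, rfl⟩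
  exact h S hS

lemma generalizedConnectivity_three_le [Finite V] {G : SimpleGraph V} {S : Finset V}
    (hS : S.card = 3) : G.generalizedConnectivity 3 ≤ G.steinerConnectivity S := by
  cases nonempty_fintype V
  have hV : S.card ≤ Nat.card V := by
    rw [Nat.card_eq_fintype_card]; exact Finset.card_le_univ S
  rw [generalizedConnectivity, if_neg (by omega)]
  exact Nat.sInf_le ⟨S, hS, rfl⟩

lemma exists_isPacking_of_subsingleton [Finite V] {G : SimpleGraph V} {ι : Type*} [Finite ι]
    {v : ι → V} (hv : Function.Injective v) (hι : Nat.card ι ≤ G.vertexConnectivity) {R : Set V}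
    (hR : R.Subsingleton) :
    ∃ K : ι → G.Subgraph, G.IsPacking R K ∧ ∀ i, v i ∈ (K i).verts := by
  rcases hR.eq_empty_or_singleton with rfl | ⟨z, rfl⟩
  · exact ⟨_, G.isPacking_singletonSubgraph hv, fun i => by simp⟩
  · exact exists_isPacking_singleton hv hι z

/-- In `G □ H`, the copy of `G` in the fibre over `w'` with pendant edges to the vertices of `S` in
an adjacent fibre. -/
lemma exists_connected_subgraph_adjacent_fibre {G : SimpleGraph V} {H : SimpleGraph W}
    (hG : G.Connected) {w w' : W} (hw : H.Adj w w') (S : Set V) :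
    ∃ D : (G □ H).Subgraph, D.Connected ∧ (fun u => (u, w)) '' S ⊆ D.verts ∧
      (∀ u, (u, w) ∈ D.verts → u ∈ S) ∧ ∀ p q, D.Adj p q → p.2 = w' ∨ q.2 = w' := by
  let D : (G □ H).Subgraph :=
    { verts := {p | p.2 = w' ∨ p.2 = w ∧ p.1 ∈ S}
      Adj := fun p q => (p.2 = w' ∨ p.2 = w ∧ p.1 ∈ S) ∧ (q.2 = w' ∨ q.2 = w ∧ q.1 ∈ S) ∧
        (p.2 = w' ∨ q.2 = w') ∧ (G □ H).Adj p q
      adj_sub := fun h => h.2.2.2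
      edge_vert := fun h => h.1
      symm := ⟨fun p q h => ⟨h.2.1, h.1, h.2.2.1.symm, h.2.2.2.symm⟩⟩ }
  refine ⟨D, ?_, ?_, ?_, fun p q h => h.2.2.1⟩
  · let f : G →g D.coe := ⟨fun u => ⟨(u, w'), Or.inl rfl⟩, fun h =>
      ⟨Or.inl rfl, Or.inl rfl, Or.inl rfl, boxProd_adj_left.2 h⟩⟩
    obtain ⟨u₀⟩ := hG.nonempty
    refine ⟨(connected_iff_exists_forall_reachable _).2 ⟨f u₀, ?_⟩⟩
    rintro ⟨⟨u, z⟩, hz⟩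
    have h1 := (hG.preconnected u₀ u).map f
    rcases hz with rfl | ⟨rfl, hu⟩
    · exact h1
    · refine h1.trans (Adj.reachable ?_)
      exact ⟨Or.inl rfl, Or.inr ⟨rfl, hu⟩, Or.inl rfl, boxProd_adj_right.2 hw.symm⟩
  · rintro _ ⟨u, hu, rfl⟩
    exact Or.inr ⟨rfl, hu⟩
  · rintro u (h | h)
    · exact absurd h hw.ne
    · exact h.2

/-- If `G` is `(k + 1)`-connected and any three vertices of `G` are joined by `k` internally
disjoint trees, then any three vertices of `G □ H` are joined by `k + 1` of them. -/
theorem add_one_le_generalizedConnectivity_boxProd [Finite V] [Finite W] [Nontrivial W]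
    {G : SimpleGraph V} {H : SimpleGraph W} (hG : G.Connected) (hH : H.Connected) {k : ℕ}
    (hκ : k + 1 ≤ G.vertexConnectivity)
    (h3 : ∀ S : Finset V, S.card = 3 → k ≤ G.steinerConnectivity S) :
    k + 1 ≤ (G □ H).generalizedConnectivity 3 := by
  classical
  have hV : k + 1 < Nat.card V := hκ.trans_lt (vertexConnectivity_lt_card hG.nonempty)
  have hW : 1 < Nat.card W := Finite.one_lt_card
  refine le_generalizedConnectivity_three ?_ fun S hS => ?_
  · rw [Nat.card_prod]
    nlinarith
  have hfinish {ι : Type} [Finite ι] (hι : Nat.card ι = k + 1)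
      (h : ∃ C : ι → (G □ H).Subgraph, (G □ H).IsPacking S C) :
      k + 1 ≤ (G □ H).steinerConnectivity S := by
    obtain ⟨C, hC⟩ := h
    exact hι ▸ hC.card_le_steinerConnectivity (by omega)
  by_cases hpair : ∃ w x y, x ≠ y ∧ (x, w) ∈ S ∧ (y, w) ∈ S
  · obtain ⟨w, x, y, hxy, hx, hy⟩ := hpair
    have hcard : ((S.erase (x, w)).erase (y, w)).card = 1 := by
      rw [Finset.card_erase_of_mem (by simp [hy, hxy.symm]), Finset.card_erase_of_mem hx, hS]
    obtain ⟨⟨z, c⟩, hz⟩ := Finset.card_eq_one.1 hcard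
    have hzS : (z, c) ∈ (S.erase (x, w)).erase (y, w) := by simp [hz]
    simp only [Finset.mem_erase] at hzS
    have hS' : ∀ p, p ∈ S ↔ p = (x, w) ∨ p = (y, w) ∨ p = (z, c) := by
      intro p
      constructor
      · intro hp
        by_contra! hne
        have : p ∈ (S.erase (x, w)).erase (y, w) := by simp [hp, hne]
        rw [hz, Finset.mem_singleton] at this
        exact hne.2.2 this
      · rintro (rfl | rfl | rfl)
        exacts [hx, hy, hzS.2.2]
    by_cases hcw : c = w
    · -- The three vertices lie in one fibre.
      subst hcw
      have hxz : x ≠ z := by rintro rfl; exact hzS.2.1 rfl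
      have hyz : y ≠ z := by rintro rfl; exact hzS.1 rfl
      obtain ⟨C, hC⟩ := exists_isPacking_of_le_steinerConnectivity (G := G) (S := {x, y, z})
        (by rw [Finset.card_eq_three.2 ⟨x, y, z, hxy, hxz, hyz, rfl⟩]; omega)
        (h3 {x, y, z} (Finset.card_eq_three.2 ⟨x, y, z, hxy, hxz, hyz, rfl⟩))
      obtain ⟨c', hc'⟩ := hH.preconnected.exists_adj_of_nontrivial c
      obtain ⟨D, hD, hDS, hDv, hDa⟩ := exists_connected_subgraph_adjacent_fibre hG hc'
        (({x, y, z} : Finset V) : Set V)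
      have hC' := hC.map (G.boxProdLeft H c).toHom (G.boxProdLeft H c).injective
      have himage : (G.boxProdLeft H c).toHom '' (({x, y, z} : Finset V) : Set V) = S := by
        ext ⟨u, b⟩
        simp only [Set.mem_image, Finset.mem_coe, hS']
        constructor
        · rintro ⟨u', hu', h⟩
          obtain ⟨rfl, rfl⟩ : u' = u ∧ c = b := Prod.ext_iff.1 h
          simpa using hu'
        · intro h
          have h' : (u = x ∨ u = y ∨ u = z) ∧ b = c := by
            simp only [Prod.mk.injEq] at h; tauto
          exact ⟨u, by simpa using h'.1, Prod.ext rfl h'.2.symm⟩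
      rw [himage] at hC'
      refine hfinish (ι := Option (Fin k)) (by simp) ⟨_, hC'.option hD ?_ ?_ ?_⟩
      · rw [← himage]; exact hDS
      · rintro i v hv ⟨u, hu, rfl⟩
        rw [← himage]
        exact ⟨u, hDv u hv, rfl⟩
      · rintro i p q hpq ⟨a, b, hab, rfl, rfl⟩
        rcases hDa _ _ hpq with h | h
        exacts [hc'.ne h, hc'.ne h]
    · -- Exactly two of the vertices lie in a common fibre.
      obtain ⟨v, K, hv, hK, hvK⟩ := exists_isPacking_pair hxy hκ
      refine hfinish (ι := Fin (k + 1)) (by simp) (exists_isPacking_boxProd hH hv fun b => ?_)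
      by_cases hb : b = w
      · have hR : {u | (u, b) ∈ (S : Set (V × W))} = {x, y} := by
          ext u
          simp only [Set.mem_ofPred_eq, Finset.mem_coe, hS', Prod.mk.injEq, hb, and_true,
            Ne.symm hcw, and_false, or_false, Set.mem_insert_iff, Set.mem_singleton_iff]
        rw [hR]
        exact ⟨K, hK, hvK⟩
      · refine exists_isPacking_of_subsingleton hv (by simpa using hκ) fun u hu u' hu' => ?_
        simp only [Set.mem_ofPred_eq, Finset.mem_coe, hS', Prod.mk.injEq, hb, and_false,
          false_or] at hu hu'
        rw [hu.1, hu'.1]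
  · -- The three vertices lie in distinct fibres.
    push Not at hpair
    cases nonempty_fintype V
    have hle : Fintype.card (Fin (k + 1)) ≤ Fintype.card V := by
      rw [Fintype.card_fin, ← Nat.card_eq_fintype_card]; omega
    obtain ⟨v⟩ := Function.Embedding.nonempty_of_card_le hle
    refine hfinish (ι := Fin (k + 1)) (by simp)
      (exists_isPacking_boxProd hH v.injective fun b => ?_)
    refine exists_isPacking_of_subsingleton v.injective (by simpa using hκ) fun u hu u' hu' => ?_
    by_contra hne
    exact hpair b u u' hne hu hu'

lemma generalizedConnectivity_three_mono_of_iso [Finite V] [Finite W] {G : SimpleGraph V}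
    {H : SimpleGraph W} (e : G ≃g H) :
    G.generalizedConnectivity 3 ≤ H.generalizedConnectivity 3 := by
  classical
  have hcard : Nat.card V = Nat.card W := Nat.card_congr e.toEquiv
  by_cases hV : Nat.card V < 3
  · rw [generalizedConnectivity, generalizedConnectivity, ← hcard, if_pos hV, if_pos hV]
    simp only [e.connected_iff, le_refl]
  · refine le_generalizedConnectivity_three (by omega) fun S hS => ?_
    have hS' : (S.map e.symm.toEquiv.toEmbedding).card = 3 := by rw [Finset.card_map, hS]
    obtain ⟨C, hC⟩ := exists_isPacking_of_le_steinerConnectivity (by omega)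
      (generalizedConnectivity_three_le (G := G) hS')
    have hC' := hC.map e.toHom e.injective
    have himage : e.toHom '' (S.map e.symm.toEquiv.toEmbedding : Finset V) = (S : Set W) := by
      ext u
      simp
    rw [himage] at hC'
    simpa using hC'.card_le_steinerConnectivity (by omega)

theorem generalizedConnectivity_le_boxProd [Finite V] [Finite W] {G : SimpleGraph V}
    {H : SimpleGraph W} (hG : G.Connected) (hH : H.Connected)
    (hκ : G.generalizedConnectivity 3 = G.vertexConnectivity) (h1 : 1 ≤ G.vertexConnectivity) :
    G.generalizedConnectivity 3 ≤ (G □ H).generalizedConnectivity 3 := by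
  rcases subsingleton_or_nontrivial W with hW | hW
  · obtain ⟨w⟩ := hH.nonempty
    refine generalizedConnectivity_three_mono_of_iso
      (RelIso.ofSurjective (G.boxProdLeft H w) ?_)
    rintro ⟨u, w'⟩
    exact ⟨u, Prod.ext rfl (Subsingleton.elim _ _)⟩
  · obtain ⟨k, hk⟩ := Nat.exists_eq_add_of_le' h1
    rw [hκ, hk]
    refine add_one_le_generalizedConnectivity_boxProd hG hH hk.ge fun S hS => ?_
    have := generalizedConnectivity_three_le (G := G) hS
    omega

end BoxProd

/-! ### Upper bounds from degrees -/

section Degree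

variable {V W : Type*} {G : SimpleGraph V}

lemma IsPacking.exists_adj {R : Set V} {ι : Type*} {C : ι → G.Subgraph} (hC : G.IsPacking R C)
    (hR : R.Nontrivial) {u : V} (hu : u ∈ R) (i : ι) : ∃ x, (C i).Adj u x := by
  have : Nontrivial (C i).verts := (hR.mono (hC.subset i)).coe_sort
  obtain ⟨x, hx⟩ :=
    (hC.connected i).coe.preconnected.exists_adj_of_nontrivial ⟨u, hC.subset i hu⟩
  exact ⟨x, hx⟩

lemma IsPacking.card_le_ncard_neighborSet [Finite V] {R : Set V} {ι : Type*}
    {C : ι → G.Subgraph} (hC : G.IsPacking R C) (hR : R.Nontrivial) {u : V} (hu : u ∈ R) :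
    Nat.card ι ≤ (G.neighborSet u).ncard := by
  choose x hx using hC.exists_adj hR hu
  refine Nat.card_le_card_of_injective (fun i => (⟨x i, (C i).adj_sub (hx i)⟩ : G.neighborSet u))
    fun i j hij => ?_
  by_contra hne
  refine hC.not_adj i j hne u (x i) (hx i) ?_
  have hij' : x i = x j := congrArg Subtype.val hij
  exact hij' ▸ hx j

/-- A packing with as many members as `u` has neighbours uses every edge at `u`, each in a different
member. -/
lemma IsPacking.exists_adj_and_unique_of_ncard_le [Finite V] {R : Set V} {ι : Type*}
    {C : ι → G.Subgraph} (hC : G.IsPacking R C) (hR : R.Nontrivial) {u : V} (hu : u ∈ R)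
    (hle : (G.neighborSet u).ncard ≤ Nat.card ι) :
    (∀ x, G.Adj u x → ∃ i, (C i).Adj u x) ∧
      ∀ i x y, (C i).Adj u x → (C i).Adj u y → x = y := by
  choose x hx using hC.exists_adj hR hu
  let f : ι → G.neighborSet u := fun i => ⟨x i, (C i).adj_sub (hx i)⟩
  have hf : Function.Injective f := fun i j hij => by
    by_contra hne
    refine hC.not_adj i j hne u (x i) (hx i) ?_
    have hij' : x i = x j := congrArg Subtype.val hij
    exact hij' ▸ hx j
  have hfs : Function.Surjective f := (hf.bijective_of_nat_card_le hle).2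
  have hall : ∀ y, G.Adj u y → ∃ i, x i = y := fun y hy => by
    obtain ⟨i, hi⟩ := hfs ⟨y, hy⟩
    exact ⟨i, congrArg Subtype.val hi⟩
  have huniq : ∀ i y, (C i).Adj u y → y = x i := by
    intro i y hy
    obtain ⟨j, rfl⟩ := hall y ((C i).adj_sub hy)
    by_contra hne
    exact hC.not_adj i j (fun h => hne (h ▸ rfl)) u _ hy (hx j)
  refine ⟨fun y hy => ?_, fun i y z hy hz => (huniq i y hy).trans (huniq i z hz).symm⟩
  obtain ⟨i, rfl⟩ := hall y hy
  exact ⟨i, hx i⟩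

lemma generalizedConnectivity_three_le_ncard_neighborSet [Finite V] (hV : 3 ≤ Nat.card V) (u : V) :
    G.generalizedConnectivity 3 ≤ (G.neighborSet u).ncard := by
  classical
  cases nonempty_fintype V
  rw [Nat.card_eq_fintype_card] at hV
  obtain ⟨S, hu, -, hS⟩ := Finset.exists_subsuperset_card_eq (s := {u}) (t := Finset.univ) (n := 3)
    (Finset.subset_univ _) (by simp) hV
  obtain ⟨C, hC⟩ := exists_isPacking_of_le_steinerConnectivity (S := S) (by omega)
    (generalizedConnectivity_three_le (G := G) hS)
  have hnt : (S : Set V).Nontrivial := Finset.one_lt_card_iff_nontrivial.1 (by omega)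
  simpa using hC.card_le_ncard_neighborSet hnt (u := u) (by simpa using hu)

/-- Two adjacent vertices `u`, `v` of degree at most `d + 1` cannot lie in `d + 1` internally
disjoint trees with a third vertex: the tree that contains the edge `uv` would consist of this edge
alone. -/
lemma generalizedConnectivity_three_le_of_adj [Finite V] (hV : 3 ≤ Nat.card V) {u v : V}
    (huv : G.Adj u v) {d : ℕ} (hu : (G.neighborSet u).ncard ≤ d + 1)
    (hv : (G.neighborSet v).ncard ≤ d + 1) : G.generalizedConnectivity 3 ≤ d := by
  classical
  cases nonempty_fintype V
  rw [Nat.card_eq_fintype_card] at hV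
  obtain ⟨w, -, hw⟩ := Finset.exists_mem_notMem_of_card_lt_card (s := {u, v}) (t := Finset.univ)
    (by rw [Finset.card_univ]; exact Finset.card_le_two.trans_lt hV)
  simp only [Finset.mem_insert, Finset.mem_singleton, not_or] at hw
  have hS : ({u, v, w} : Finset V).card = 3 :=
    Finset.card_eq_three.2 ⟨u, v, w, huv.ne, Ne.symm hw.1, Ne.symm hw.2, rfl⟩
  by_contra! hlt
  obtain ⟨C, hC⟩ := exists_isPacking_of_le_steinerConnectivity (S := {u, v, w}) (r := d + 1)
    (by omega) (hlt.trans_le (generalizedConnectivity_three_le (G := G) hS))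
  have hnt : (({u, v, w} : Finset V) : Set V).Nontrivial :=
    Finset.one_lt_card_iff_nontrivial.1 (by omega)
  obtain ⟨hu1, hu2⟩ := hC.exists_adj_and_unique_of_ncard_le hnt (u := u) (by simp)
    (by simpa using hu)
  obtain ⟨-, hv2⟩ := hC.exists_adj_and_unique_of_ncard_le hnt (u := v) (by simp) (by simpa using hv)
  obtain ⟨i, hi⟩ := hu1 v huv
  have hsub := hC.subset i
  obtain ⟨p⟩ := (hC.connected i).coe.preconnected ⟨u, hsub (by simp)⟩ ⟨w, hsub (by simp)⟩
  have key : ∀ a b : (C i).verts, (C i).coe.Walk a b → (a.1 = u ∨ a.1 = v) →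
      (b.1 = u ∨ b.1 = v) := by
    intro a b p
    induction p with
    | nil => exact id
    | @cons a b c hadj _ ih =>
      have hab : (C i).Adj a.1 b.1 := hadj
      rintro (ha | ha)
      · rw [ha] at hab
        exact ih (Or.inr (hu2 i _ _ hab hi))
      · rw [ha] at hab
        exact ih (Or.inl (hv2 i _ _ hab hi.symm))
  rcases key _ _ p (Or.inl rfl) with h | h
  exacts [hw.1 h, hw.2 h]

lemma ncard_neighborSet_boxProd_le [Finite V] [Finite W] {H : SimpleGraph W} (x : V × W) :
    ((G □ H).neighborSet x).ncard ≤ (G.neighborSet x.1).ncard + (H.neighborSet x.2).ncard := by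
  rw [neighborSet_boxProd]
  refine (Set.ncard_union_le _ _).trans ?_
  simp [Set.ncard_prod]

lemma isTree_top_bool : (⊤ : SimpleGraph Bool).IsTree := by
  refine ⟨connected_top, ?_⟩
  refine isAcyclic_iff_forall_adj_isBridge.2 fun {u v} huv => ?_
  rw [isBridge_iff]
  rintro ⟨p⟩
  have h : ∀ a b : Bool, ¬ ((⊤ : SimpleGraph Bool).deleteEdges {s(u, v)}).Adj a b := by
    intro a b hab
    rw [deleteEdges_adj] at hab
    have hab1 := hab.1.ne
    have huv1 := huv.ne
    refine hab.2 ?_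
    revert hab1 huv1
    clear hab huv p
    revert a b u v
    simp only [Set.mem_singleton_iff]
    decide
  cases p with
  | nil => exact huv.ne rfl
  | cons hadj _ => exact h _ _ hadj

/-- A vertex `u` of degree at most `d` yields two adjacent vertices of degree at most `d + 1` in the
prism over `G`. -/
lemma generalizedConnectivity_three_boxProd_top_bool_le [Finite V] (hV : 2 ≤ Nat.card V) {u : V}
    {d : ℕ} (hu : (G.neighborSet u).ncard ≤ d) :
    (G □ (⊤ : SimpleGraph Bool)).generalizedConnectivity 3 ≤ d := by
  have hdeg (b : Bool) : ((G □ (⊤ : SimpleGraph Bool)).neighborSet (u, b)).ncard ≤ d + 1 := by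
    refine (ncard_neighborSet_boxProd_le _).trans (Nat.add_le_add hu ?_)
    have : (⊤ : SimpleGraph Bool).neighborSet b ⊆ {!b} := by
      intro c hc
      have hc' : b ≠ c := hc
      revert hc'
      clear hc
      revert b c
      simp
    exact (Set.ncard_le_ncard this).trans (by simp)
  refine generalizedConnectivity_three_le_of_adj (u := (u, false)) (v := (u, true)) ?_ ?_
    (hdeg _) (hdeg _)
  · rw [Nat.card_prod]; simp; omega
  · exact boxProd_adj_right.2 (by simp)

end Degree

/-! ### Extremal examples -/

section Examples

variable {V : Type*} {G : SimpleGraph V}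

/-- The star with centre `c` and set of leaves `R`. -/
def starSubgraph (G : SimpleGraph V) (c : V) (R : Set V) (h : ∀ s ∈ R, G.Adj c s) :
    G.Subgraph where
  verts := insert c R
  Adj p q := p = c ∧ q ∈ R ∨ q = c ∧ p ∈ R
  adj_sub := by
    rintro p q (⟨rfl, hq⟩ | ⟨rfl, hp⟩)
    exacts [h q hq, (h p hp).symm]
  edge_vert := by
    rintro p q (⟨rfl, hq⟩ | ⟨rfl, hp⟩)
    exacts [Or.inl rfl, Or.inr hp]
  symm := ⟨fun _ _ h => h.symm⟩

lemma connected_starSubgraph {c : V} {R : Set V} (h : ∀ s ∈ R, G.Adj c s) :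
    (starSubgraph G c R h).Connected := by
  refine ⟨(connected_iff_exists_forall_reachable _).2 ⟨⟨c, Or.inl rfl⟩, ?_⟩⟩
  rintro ⟨s, rfl | hs⟩
  · exact Reachable.refl _
  · exact Adj.reachable (Or.inl ⟨rfl, hs⟩)

lemma isPacking_starSubgraph {R : Set V} {ι : Type*} {c : ι → V} (hc : Function.Injective c)
    (hcR : ∀ i, c i ∉ R) (h : ∀ i, ∀ s ∈ R, G.Adj (c i) s) :
    G.IsPacking R fun i => starSubgraph G (c i) R (h i) where
  connected i := connected_starSubgraph (h i)
  subset i := Set.subset_insert _ _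
  verts_inter := by
    rintro i j hij v (rfl | hv) (hv' | hv')
    exacts [absurd (hc hv') hij, hv', hv, hv]
  not_adj := by
    rintro i j hij u v (⟨rfl, hv⟩ | ⟨rfl, hu⟩) (⟨h1, h2⟩ | ⟨h1, h2⟩)
    exacts [hij (hc h1), hcR i h2, hcR i h2, hij (hc h1)]

lemma le_steinerConnectivity_top (k : ℕ) {S : Finset (Fin (k + 2))} (hS : S.card = 3) :
    k ≤ (⊤ : SimpleGraph (Fin (k + 2))).steinerConnectivity S := by
  have hcard : (Sᶜ : Finset (Fin (k + 2))).card + 1 = k := by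
    have := Finset.card_le_univ S
    rw [Finset.card_compl, Fintype.card_fin, hS]
    rw [Fintype.card_fin, hS] at this
    omega
  have hstar := isPacking_starSubgraph (G := (⊤ : SimpleGraph (Fin (k + 2))))
    (R := S) (c := fun i : (Sᶜ : Finset (Fin (k + 2))) => i.1) Subtype.val_injective
    (fun i => Finset.mem_compl.1 i.2) (fun i s hs => by
      rintro rfl
      exact Finset.mem_compl.1 i.2 hs)
  -- The last tree is a path on `S`.
  obtain ⟨x, y, z, hxy, hxz, hyz, rfl⟩ := Finset.card_eq_three.1 hS
  have hR : ∀ s ∈ ({x, z} : Set (Fin (k + 2))), (⊤ : SimpleGraph (Fin (k + 2))).Adj y s := by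
    rintro s (rfl | rfl)
    exacts [hxy.symm, hyz]
  have hverts : ∀ v, v ∈ (starSubgraph ⊤ y {x, z} hR).verts ↔
      v ∈ ((({x, y, z} : Finset (Fin (k + 2))) : Set (Fin (k + 2)))) := by
    intro v
    simp only [starSubgraph, Set.mem_insert_iff, Set.mem_singleton_iff, Finset.coe_insert,
      Finset.coe_singleton]
    tauto
  have h := hstar.option (connected_starSubgraph hR) (fun v hv => (hverts v).2 hv)
    (fun i v hv _ => (hverts v).1 hv) (by
      rintro i u v huv (⟨rfl, _⟩ | ⟨rfl, _⟩)
      · exact Finset.mem_compl.1 i.2 ((hverts _).1 huv.fst_mem)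
      · exact Finset.mem_compl.1 i.2 ((hverts _).1 huv.snd_mem))
  have := h.card_le_steinerConnectivity (by omega)
  rwa [Nat.card_eq_fintype_card, Fintype.card_option, Fintype.card_coe, hcard] at this

lemma ncard_neighborSet_top_le (k : ℕ) (u : Fin (k + 2)) :
    ((⊤ : SimpleGraph (Fin (k + 2))).neighborSet u).ncard ≤ k + 1 := by
  have : (⊤ : SimpleGraph (Fin (k + 2))).neighborSet u ⊆
      ((Finset.univ.erase u : Finset _) : Set _) :=
    fun v hv => by simpa using ((mem_neighborSet _ _ _).1 hv).ne'
  refine (Set.ncard_le_ncard this).trans ?_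
  rw [Set.ncard_coe_finset, Finset.card_erase_of_mem (Finset.mem_univ u), Finset.card_univ,
    Fintype.card_fin]
  omega

lemma add_one_le_vertexConnectivity_top (k : ℕ) :
    k + 1 ≤ (⊤ : SimpleGraph (Fin (k + 2))).vertexConnectivity := by
  refine le_vertexConnectivity fun X hX => ⟨fun u v hu hv => ?_, ?_⟩
  · by_cases huv : u = v
    · exact huv ▸ .refl hu
    · exact .of_adj huv hu hv
  · have : 1 < (Xᶜ).card := by rw [Finset.card_compl, Fintype.card_fin]; omega
    obtain ⟨u, hu, v, hv, huv⟩ := Finset.one_lt_card.1 this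
    exact ⟨u, v, Finset.mem_compl.1 hu, Finset.mem_compl.1 hv, huv⟩

/-- A complete graph on `k + (k + 2)` vertices with one more vertex `none`, joined to the first `k`
of them. -/
def attachedVertexGraph (k : ℕ) : SimpleGraph (Option (Fin k ⊕ Fin (k + 2))) where
  Adj
    | none, none => False
    | none, some b => b.isLeft
    | some a, none => a.isLeft
    | some a, some b => a ≠ b
  symm := ⟨by rintro (_ | a) (_ | b) h; exacts [h, h, h, Ne.symm h]⟩
  loopless := ⟨by rintro (_ | a) h; exacts [h, h rfl]⟩

lemma attachedVertexGraph_adj_inl {k : ℕ} (i : Fin k) (x : Option (Fin k ⊕ Fin (k + 2)))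
    (hx : x ≠ some (.inl i)) : (attachedVertexGraph k).Adj (some (.inl i)) x := by
  rcases x with _ | x
  · rfl
  · exact fun h => hx (h ▸ rfl)

lemma vertexConnectivity_attachedVertexGraph (k : ℕ) :
    (attachedVertexGraph k).vertexConnectivity = k := by
  classical
  apply le_antisymm
  · let S : Finset (Option (Fin k ⊕ Fin (k + 2))) :=
      Finset.univ.image fun i : Fin k => some (.inl i)
    have hS : S.card ≤ k := Finset.card_image_le.trans (by simp)
    refine (vertexConnectivity_le (S := S) (Or.inl fun h => ?_)).trans hS
    have hn : none ∈ ((S : Set (Option (Fin k ⊕ Fin (k + 2))))ᶜ) := by simp [S]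
    have h0 : some (.inr 0) ∈ ((S : Set (Option (Fin k ⊕ Fin (k + 2))))ᶜ) := by simp [S]
    have : Nontrivial ((S : Set (Option (Fin k ⊕ Fin (k + 2))))ᶜ : Set _) :=
      ⟨⟨none, hn⟩, ⟨_, h0⟩, fun h => by simpa using congrArg Subtype.val h⟩
    obtain ⟨⟨_ | i | j, hx⟩, hadj⟩ := h.exists_adj_of_nontrivial ⟨none, hn⟩
    · exact hadj.ne rfl
    · exact hx (by simp [S])
    · exact Bool.false_ne_true hadj
  · refine le_vertexConnectivity fun X hX => ?_
    have hinl : ∃ i : Fin k, some (.inl i) ∉ X := by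
      by_contra! hcon
      have : (Finset.univ.image fun i : Fin k => (some (.inl i) : Option (Fin k ⊕ Fin (k + 2)))) ⊆ X
          := by
        intro x hx
        obtain ⟨i, -, rfl⟩ := Finset.mem_image.1 hx
        exact hcon i
      have h1 := Finset.card_le_card this
      rw [Finset.card_image_of_injective _ fun i j hij => by simpa using hij,
        Finset.card_univ, Fintype.card_fin] at h1
      omega
    obtain ⟨i, hi⟩ := hinl
    have hreach : ∀ x, x ∉ X → (attachedVertexGraph k).ReachableAvoiding X (some (.inl i)) x := by
      intro x hx
      by_cases hxi : x = some (.inl i)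
      · exact hxi ▸ .refl hx
      · exact .of_adj (attachedVertexGraph_adj_inl i x hxi) hi hx
    refine ⟨fun u v hu hv => (hreach u hu).symm.trans (hreach v hv), ?_⟩
    have : 1 < (Xᶜ).card := by
      rw [Finset.card_compl, Fintype.card_option, Fintype.card_sum, Fintype.card_fin,
        Fintype.card_fin]
      omega
    obtain ⟨u, hu, v, hv, huv⟩ := Finset.one_lt_card.1 this
    exact ⟨u, v, Finset.mem_compl.1 hu, Finset.mem_compl.1 hv, huv⟩

lemma ncard_neighborSet_attachedVertexGraph_none (k : ℕ) :
    ((attachedVertexGraph k).neighborSet none).ncard ≤ k := by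
  have : (attachedVertexGraph k).neighborSet none ⊆
      Set.range fun i : Fin k => (some (.inl i) : Option (Fin k ⊕ Fin (k + 2))) := by
    rintro (_ | i | j) h
    · exact h.elim
    · exact ⟨i, rfl⟩
    · exact absurd h (by simp [attachedVertexGraph])
  refine (Set.ncard_le_ncard this).trans ?_
  rw [← Set.image_univ]
  exact (Set.ncard_image_le).trans (by simp)

/-- For `none ∈ S`, the trees on `S = {none, y, z}` consist of an edge from `none` to a neighbour
`a` and a star whose centre `b` is a nonneighbour of `none` and whose leaves are `a`, `y` and `z`. -/
lemma le_steinerConnectivity_attachedVertexGraph {k : ℕ}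
    {S : Finset (Option (Fin k ⊕ Fin (k + 2)))} (hS : S.card = 3) :
    k ≤ (attachedVertexGraph k).steinerConnectivity S := by
  classical
  suffices h : ∃ C : Fin k → (attachedVertexGraph k).Subgraph,
      (attachedVertexGraph k).IsPacking S C by
    obtain ⟨C, hC⟩ := h
    simpa using hC.card_le_steinerConnectivity (by omega)
  by_cases hnone : none ∈ S
  · let B : Finset (Fin (k + 2)) := Finset.univ.filter fun j => some (.inr j) ∉ S
    have hB : k ≤ B.card := by
      have h1 := Finset.card_filter_add_card_filter_not (s := (Finset.univ : Finset (Fin (k + 2))))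
        (fun j => (some (.inr j) : Option (Fin k ⊕ Fin (k + 2))) ∈ S)
      have h2 : (Finset.univ.filter fun j : Fin (k + 2) =>
          (some (.inr j) : Option (Fin k ⊕ Fin (k + 2))) ∈ S).card ≤ (S.erase none).card := by
        refine Finset.card_le_card_of_injOn (fun j => some (.inr j)) (fun j hj => ?_)
          ((Option.some_injective _).comp Sum.inr_injective).injOn
        simpa using hj
      rw [Finset.card_erase_of_mem hnone, hS] at h2
      rw [Finset.card_univ, Fintype.card_fin] at h1
      simp only [B]
      omega
    obtain ⟨g⟩ : Nonempty (Fin k ↪ B) := Function.Embedding.nonempty_of_card_le (by simpa using hB)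
    have hgS (i : Fin k) : some (.inr (g i).1) ∉ S := (Finset.mem_filter.1 (g i).2).2
    let a (i : Fin k) : Option (Fin k ⊕ Fin (k + 2)) := some (.inl i)
    let b (i : Fin k) : Option (Fin k ⊕ Fin (k + 2)) := some (.inr (g i).1)
    have hb : Function.Injective b := fun i j hij =>
      g.injective (Subtype.ext (by simpa [b] using hij))
    let L (i : Fin k) : Set (Option (Fin k ⊕ Fin (k + 2))) := insert (a i) (S.erase none : Finset _)
    have hL (i : Fin k) : ∀ s ∈ L i, (attachedVertexGraph k).Adj (b i) s := by
      rintro s (rfl | hs)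
      · exact Sum.inr_ne_inl
      · rcases s with _ | s
        · simp at hs
        · rintro rfl
          exact hgS i (Finset.mem_of_mem_erase hs)
    have hna (i : Fin k) : (attachedVertexGraph k).Adj none (a i) := rfl
    let C (i : Fin k) : (attachedVertexGraph k).Subgraph :=
      starSubgraph _ (b i) (L i) (hL i) ⊔ (attachedVertexGraph k).subgraphOfAdj (hna i)
    have hverts (i : Fin k) (v) : v ∈ (C i).verts ↔ v = b i ∨ v = a i ∨ v ∈ S := by
      have h1 : v ∈ (C i).verts ↔ (v = b i ∨ v = a i ∨ v ∈ S.erase none) ∨ v = none ∨ v = a i :=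
        Iff.rfl
      rw [h1, Finset.mem_erase]
      by_cases hv : v = none
      · simp [hv, hnone]
      · tauto
    have hbC (i j : Fin k) (hij : i ≠ j) : b i ∉ (C j).verts := by
      rw [hverts]
      rintro (h | h | h)
      exacts [hij (hb h), by simp [a, b] at h, hgS i h]
    refine ⟨C, ?_, ?_, ?_, ?_⟩
    · exact fun i => Subgraph.connected_sup (connected_starSubgraph (hL i)).preconnected
        (Subgraph.subgraphOfAdj_connected (hna i)).preconnected
        ⟨a i, Or.inr (Or.inl rfl), Or.inr rfl⟩
    · exact fun i v hv => (hverts i v).2 (Or.inr (Or.inr hv))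
    · intro i j hij v hi hj
      rw [hverts] at hi hj
      rcases hi with rfl | rfl | hi
      · rcases hj with h | h | h
        exacts [absurd (hb h) hij, by simp [a, b] at h, h]
      · rcases hj with h | h | h
        exacts [by simp [a, b] at h, absurd (by simpa [a] using h) hij, h]
      · exact hi
    · intro i j hij u v hi hj
      -- The edges at `b i` lie in the `i`-th tree only.
      have hstar (i j : Fin k) (hij : i ≠ j) (hj : (C j).Adj u v) :
          ¬ (starSubgraph _ (b i) (L i) (hL i)).Adj u v := by
        rintro (⟨rfl, _⟩ | ⟨rfl, _⟩)
        exacts [hbC i j hij hj.fst_mem, hbC i j hij hj.snd_mem]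
      have hi' := Or.resolve_left hi (hstar i j hij hj)
      have hj' := Or.resolve_left hj (hstar j i hij.symm hi)
      have h1 : s(none, a i) = s(none, a j) := Eq.trans hi' (Eq.symm hj')
      exact hij (by simpa [a] using h1)
  · have hcard : k ≤ ((insert none S)ᶜ).card := by
      rw [Finset.card_compl, Finset.card_insert_of_notMem hnone, Fintype.card_option,
        Fintype.card_sum, Fintype.card_fin, Fintype.card_fin]
      omega
    obtain ⟨g⟩ : Nonempty (Fin k ↪ ((insert none S)ᶜ : Finset _)) :=
      Function.Embedding.nonempty_of_card_le (by
        rwa [Fintype.card_fin, Fintype.card_coe])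
    have hg (i : Fin k) : (g i).1 ≠ none ∧ (g i).1 ∉ S := by
      simpa using Finset.mem_compl.1 (g i).2
    refine ⟨_, isPacking_starSubgraph (c := fun i => (g i).1)
      (Subtype.val_injective.comp g.injective) (fun i => (hg i).2) fun i s hs => ?_⟩
    have hsn : s ≠ none := by rintro rfl; exact hnone hs
    have hne : (g i).1 ≠ s := by rintro rfl; exact (hg i).2 hs
    obtain ⟨s, rfl⟩ := Option.ne_none_iff_exists'.1 hsn
    obtain ⟨c, hc⟩ := Option.ne_none_iff_exists'.1 (hg i).1
    simp only [hc] at hne ⊢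
    exact fun h => hne (h ▸ rfl)

end Examples

end SimpleGraph

theorem theorem4p1 :
    -- (i) the bound
    (∀ (V W : Type*) [Finite V] [Finite W] (G : SimpleGraph V) (T : SimpleGraph W),
      G.Connected → T.IsTree →
      G.generalizedConnectivity 3 = G.vertexConnectivity → 1 ≤ G.vertexConnectivity →
      G.generalizedConnectivity 3 ≤ (G □ T).generalizedConnectivity 3) ∧
    -- (i) sharpness
    (∀ k : ℕ, 1 ≤ k → ∃ (V W : Type) (_ : Finite V) (_ : Finite W) (G : SimpleGraph V)
      (T : SimpleGraph W), G.Connected ∧ T.IsTree ∧ Nontrivial W ∧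
      G.generalizedConnectivity 3 = k ∧ G.vertexConnectivity = k ∧
      (G □ T).generalizedConnectivity 3 = k) ∧
    -- (ii) the bound
    (∀ (V W : Type*) [Finite V] [Finite W] (G : SimpleGraph V) (T : SimpleGraph W),
      G.Connected → T.IsTree → Nontrivial W →
      1 ≤ G.generalizedConnectivity 3 →
      G.generalizedConnectivity 3 < G.vertexConnectivity →
      G.generalizedConnectivity 3 + 1 ≤ (G □ T).generalizedConnectivity 3) ∧
    -- (ii) sharpness
    (∀ k : ℕ, 1 ≤ k → ∃ (V W : Type) (_ : Finite V) (_ : Finite W) (G : SimpleGraph V)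
      (T : SimpleGraph W), G.Connected ∧ T.IsTree ∧ Nontrivial W ∧
      G.generalizedConnectivity 3 = k ∧ k < G.vertexConnectivity ∧
      (G □ T).generalizedConnectivity 3 = k + 1) := by
  open SimpleGraph in
  refine ⟨fun V W _ _ G T hG hT hκ h1 => generalizedConnectivity_le_boxProd hG hT.connected hκ h1,
    fun k hk => ?_, fun V W _ _ G T hG hT _ h1 hlt => ?_, fun k hk => ?_⟩
  · have hcard : Nat.card (Option (Fin k ⊕ Fin (k + 2))) = 2 * k + 3 := by
      rw [Nat.card_eq_fintype_card, Fintype.card_option, Fintype.card_sum, Fintype.card_fin,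
        Fintype.card_fin]
      omega
    have hκ := vertexConnectivity_attachedVertexGraph k
    have hdeg := ncard_neighborSet_attachedVertexGraph_none k
    have hκ₃ : (attachedVertexGraph k).generalizedConnectivity 3 = k :=
      ((generalizedConnectivity_three_le_ncard_neighborSet (by omega) none).trans hdeg).antisymm
        (le_generalizedConnectivity_three (by omega)
          fun S hS => le_steinerConnectivity_attachedVertexGraph hS)
    have hconn := connected_of_one_le_vertexConnectivity (hκ.symm ▸ hk)
    refine ⟨_, Bool, inferInstance, inferInstance, attachedVertexGraph k, ⊤, hconn, isTree_top_bool,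
      inferInstance, hκ₃, hκ, ?_⟩
    refine (generalizedConnectivity_three_boxProd_top_bool_le (by omega) hdeg).antisymm ?_
    have := generalizedConnectivity_le_boxProd hconn isTree_top_bool.connected
      (hκ₃.trans hκ.symm) (hκ.symm ▸ hk)
    rwa [hκ₃] at this
  · exact add_one_le_generalizedConnectivity_boxProd hG hT.connected hlt
      fun S hS => generalizedConnectivity_three_le hS
  · have hκ := add_one_le_vertexConnectivity_top k
    have hcard : 3 ≤ Nat.card (Fin (k + 2)) := by rw [Nat.card_fin]; omega
    have hlow : ∀ S : Finset (Fin (k + 2)), S.card = 3 →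
        k ≤ (⊤ : SimpleGraph (Fin (k + 2))).steinerConnectivity S :=
      fun S hS => le_steinerConnectivity_top k hS
    have hconn : (⊤ : SimpleGraph (Fin (k + 2))).Connected := connected_top
    refine ⟨_, Bool, inferInstance, inferInstance, (⊤ : SimpleGraph (Fin (k + 2))), ⊤, hconn,
      isTree_top_bool, inferInstance, ?_, hκ, ?_⟩
    · exact (generalizedConnectivity_three_le_of_adj hcard (u := 0) (v := 1) (by simp)
        (ncard_neighborSet_top_le k 0) (ncard_neighborSet_top_le k 1)).antisymm
        (le_generalizedConnectivity_three hcard hlow)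
    · exact (generalizedConnectivity_three_boxProd_top_bool_le (by omega)
        (ncard_neighborSet_top_le k 0)).antisymm
        (add_one_le_generalizedConnectivity_boxProd hconn isTree_top_bool.connected hκ hlow)
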